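/- Let $D^{2,2,2}$ be the free modular lattice with greatest element $I$ on six generators $x_i\subseteq y_i$ ($i=1,2,3$); write $+$ for join and juxtaposition for meet. Fix a field $K$. A representation $\rho$ in a finite-dimensional $K$-vector space $X_0$ is a lattice homomorphism from $D^{2,2,2}$ to the lattice of subspaces of $X_0$ with $\rho(I)=X_0$. It is indecomposable if $X_0\neq0$ and there is no decomposition $X_0=U\oplus W$ with $U,W\ne0$ and $\rho(a)=(\rho(a)\cap U)+(\rho(a)\cap W)$ for all $a$. An element $a$ is perfect if $\rho(a)\in\{0,X_0\}$ for every indecomposable $\rho$. For a representation $\rho$, let $\Phi^+\rho$ be the representation in $$X_0^1=\{(\eta_1,\eta_2,\eta_3)\mid \eta_i\in\rho(y_i),\ \eta_1+\eta_2+\eta_3=0\}$$ with $\Phi^+\rho(y_i)=\{\eta\in X_0^1\mid\eta_i\in\rho(x_i)\}$ and $\Phi^+\rho(x_i)=\{\eta\in X_0^1\mid\eta_i=0\}$, and let $\varphi_i:X_0^1\to X_0$, $\varphi_i(\eta)=\eta_i$. For $\{i,j,k\}=\{1,2,3\}$ put $a_0^{ij}=A_0^{ij}=I$ and, for $n\ge1$,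 $a_n^{ij}=x_i+y_ja_{n-1}^{jk}$ and $A_n^{ij}=y_i+x_jA_{n-1}^{ki}$. An admissible sequence is a nonempty sequence $\alpha=i_n\dots i_1$ in $\{1,2,3\}$ with $i_{p+1}\ne i_p$ for all $p$; sequences are identified under replacing a subsequence $iji$ of consecutive terms by $iki$ ($i,j,k$ distinct). Every admissible sequence is, up to this identification and a permutation of the indices $1,2,3$, one of the sequences in the following table, which defines elements $f_\alpha,e_\alpha\in D^{2,2,2}$ (the same permutation being applied to all indices). Here $p\ge0$, $q=k+3p$; $\gamma=(213)^{2p}(21)^{2k}$ with $k\ge1$; $\beta=(213)^{2p}(21)^{2k+1}$ with $k\ge0$; and $k\ge0$ in the rows for $1(21)^{2k}$ and $1(21)^{2k+1}$. For a sequence of one of these last two types, in which the roles of $2$ and $3$ may be interchanged ($1(21)^n=1(31)^n$), the row is applied after the cyclic permutation of $1,2,3$. $$\begin{array}{lll} \alpha & f_\alpha & e_\alpha\\ \gamma & y_1y_2a^{13}_qA^{32}_{k-1} & y_2A^{32}_{k-1}a^{21}_qA^{13}_ka^{13}_q\\ 3\gamma & y_3(x_1+x_2)A^{23}_qa^{31}_{k-1}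 & y_3a^{31}_{k-1}A^{12}_{q+1}a^{12}_kA^{23}_q\\ 13\gamma & y_3y_1a^{32}_{q+1}A^{21}_{k-1} & y_1A^{21}_{k-1}a^{13}_{q+1}A^{32}_ka^{32}_{q+1}\\ 213\gamma & y_2(x_3+x_1)A^{12}_{q+1}a^{23}_{k-1} & y_2a^{23}_{k-1}A^{31}_{q+2}a^{31}_kA^{12}_{q+1}\\ 3213\gamma & y_2y_3a^{21}_{q+2}A^{13}_{k-1} & y_3A^{13}_{k-1}a^{32}_{q+2}A^{21}_ka^{21}_{q+2}\\ 13213\gamma & y_1(x_2+x_3)A^{31}_{q+2}a^{12}_{k-1} & y_1a^{12}_{k-1}A^{23}_{q+3}a^{23}_kA^{31}_{q+2}\\ 1(21)^{2k} & x_1A^{23}_ka^{23}_k & y_1A^{31}_ka^{12}_kA^{23}_ka^{23}_k\\ 1(21)^{2k+1} & y_1(x_2+x_3)A^{31}_ka^{12}_k & y_1A^{31}_ka^{12}_kA^{23}_{k+1}a^{23}_{k+1}\\ \beta & y_2y_3a^{21}_qA^{13}_k & y_2A^{32}_ka^{21}_qA^{13}_ka^{13}_{q+1}\\ 3\beta &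 x_3A^{12}_{q+1}a^{12}_k & y_3a^{31}_kA^{12}_{q+1}a^{12}_kA^{23}_{q+1}\\ 13\beta & y_1y_2a^{13}_{q+1}A^{32}_k & y_1A^{21}_ka^{13}_{q+1}A^{32}_ka^{32}_{q+2}\\ 213\beta & x_2A^{31}_{q+2}a^{31}_k & y_2a^{23}_kA^{31}_{q+2}a^{31}_kA^{12}_{q+2}\\ 3213\beta & y_3y_1a^{32}_{q+2}A^{21}_k & y_3A^{13}_ka^{32}_{q+2}A^{21}_ka^{21}_{q+3}\\ 13213\beta & x_1A^{23}_{q+3}a^{23}_k & y_1a^{12}_kA^{23}_{q+3}a^{23}_kA^{31}_{q+3} \end{array}$$ For $t\in\{1,2,3\}$ and $n\ge1$ let $x_t(n)=\sum f_\alpha$ and $y_t(n)=\sum e_\alpha$, the sums over all admissible sequences $\alpha=i_n\dots i_2t$ of length $n$. For $\{i,j,k\}=\{1,2,3\}$ and $n\ge1$ let $$a_i(n)=x_j(n)+x_k(n)+y_j(n+1)+y_k(n+1),\quad b_i(n)=a_i(n)+x_i(n+1),\quad c_i(n)=a_i(n)+y_i(n+1).$$ Then: 1) for every $i$, every $n\ge2$,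 every representation $\rho$, and $v_i$ any of $a_i,b_i,c_i$, $$\rho(v_i(n))=\sum_{k=1,2,3}\varphi_k\bigl(\Phi^+\rho(v_i(n-1))\bigr);$$ 2) the elements $a_i(n)$, $b_i(n)$, $c_i(n)$ are perfect for every $n\ge1$ and $i=1,2,3$. -/

import Mathlib

universe u v w

namespace Sextuple

/-! ### The lattice `D^{2,2,2}`

The free modular lattice with a greatest element `I = ⊤` generated by `x_i ≤ y_i`, `i = 1, 2, 3`.
The index set `{1, 2, 3}` is modelled by `Fin 3`. -/

/-- Lattice polynomials in the generators `x_i`, `y_i` and the unit `I`. -/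
inductive Poly : Type
  | x (i : Fin 3) : Poly
  | y (i : Fin 3) : Poly
  | one : Poly
  | sum (a b : Poly) : Poly
  | meet (a b : Poly) : Poly

/-- The inclusions between polynomials that follow from the axioms of modular lattices, from
`x_i ≤ y_i` and from `a ≤ I`. -/
inductive Poly.Le : Poly → Poly → Prop
  | refl (a) : Poly.Le a a
  | trans {a b c} : Poly.Le a b → Poly.Le b c → Poly.Le a c
  | le_sum_left (a b) : Poly.Le a (Poly.sum a b)
  | le_sum_right (a b) : Poly.Le b (Poly.sum a b)
  | sum_le {a b c} : Poly.Le a c → Poly.Le b c → Poly.Le (Poly.sum a b) c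
  | meet_le_left (a b) : Poly.Le (Poly.meet a b) a
  | meet_le_right (a b) : Poly.Le (Poly.meet a b) b
  | le_meet {a b c} : Poly.Le a b → Poly.Le a c → Poly.Le a (Poly.meet b c)
  | modular {a c} (b) : Poly.Le a c →
      Poly.Le (Poly.meet (Poly.sum a b) c) (Poly.sum a (Poly.meet b c))
  | le_one (a) : Poly.Le a Poly.one
  | x_le_y (i) : Poly.Le (Poly.x i) (Poly.y i)

instance : Preorder Poly where
  le := Poly.Le
  le_refl := Poly.Le.refl
  le_trans := fun _ _ _ => Poly.Le.trans

/-- The modular lattice `D^{2,2,2}`. -/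
def D222 : Type := Antisymmetrization Poly (· ≤ ·)

namespace D222

instance : PartialOrder D222 := inferInstanceAs (PartialOrder (Antisymmetrization Poly (· ≤ ·)))

/-- The element of `D^{2,2,2}` given by a polynomial. -/
def mk (a : Poly) : D222 := toAntisymmetrization (· ≤ ·) a

theorem mk_le_mk {a b : Poly} : mk a ≤ mk b ↔ Poly.Le a b := Iff.rfl

theorem mk_surj (a : D222) : ∃ p, mk p = a := Quotient.exists_rep a

theorem mk_eq {a b : Poly} (h₁ : Poly.Le a b) (h₂ : Poly.Le b a) : mk a = mk b :=
  le_antisymm (mk_le_mk.2 h₁) (mk_le_mk.2 h₂)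

/-- The sum of two elements. -/
def sup : D222 → D222 → D222 :=
  Quotient.lift₂ (fun a b => mk (Poly.sum a b)) (by
    rintro a b c d ⟨h₁, h₂⟩ ⟨h₃, h₄⟩
    exact mk_eq
      (.sum_le (.trans h₁ (.le_sum_left _ _)) (.trans h₃ (.le_sum_right _ _)))
      (.sum_le (.trans h₂ (.le_sum_left _ _)) (.trans h₄ (.le_sum_right _ _))))

/-- The intersection of two elements. -/
def inf : D222 → D222 → D222 :=
  Quotient.lift₂ (fun a b => mk (Poly.meet a b)) (by
    rintro a b c d ⟨h₁, h₂⟩ ⟨h₃, h₄⟩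
    exact mk_eq
      (.le_meet (.trans (.meet_le_left _ _) h₁) (.trans (.meet_le_right _ _) h₃))
      (.le_meet (.trans (.meet_le_left _ _) h₂) (.trans (.meet_le_right _ _) h₄)))

instance : Lattice D222 where
  sup := sup
  inf := inf
  le_sup_left a b := by
    obtain ⟨a, rfl⟩ := mk_surj a; obtain ⟨b, rfl⟩ := mk_surj b
    exact Poly.Le.le_sum_left a b
  le_sup_right a b := by
    obtain ⟨a, rfl⟩ := mk_surj a; obtain ⟨b, rfl⟩ := mk_surj b
    exact Poly.Le.le_sum_right a b
  sup_le a b c h₁ h₂ := by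
    obtain ⟨a, rfl⟩ := mk_surj a; obtain ⟨b, rfl⟩ := mk_surj b; obtain ⟨c, rfl⟩ := mk_surj c
    exact Poly.Le.sum_le (mk_le_mk.1 h₁) (mk_le_mk.1 h₂)
  inf_le_left a b := by
    obtain ⟨a, rfl⟩ := mk_surj a; obtain ⟨b, rfl⟩ := mk_surj b
    exact Poly.Le.meet_le_left a b
  inf_le_right a b := by
    obtain ⟨a, rfl⟩ := mk_surj a; obtain ⟨b, rfl⟩ := mk_surj b
    exact Poly.Le.meet_le_right a b
  le_inf a b c h₁ h₂ := by
    obtain ⟨a, rfl⟩ := mk_surj a; obtain ⟨b, rfl⟩ := mk_surj b; obtain ⟨c, rfl⟩ := mk_surj c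
    exact Poly.Le.le_meet (mk_le_mk.1 h₁) (mk_le_mk.1 h₂)

theorem mk_sum (a b : Poly) : mk (Poly.sum a b) = mk a ⊔ mk b := rfl

theorem mk_meet (a b : Poly) : mk (Poly.meet a b) = mk a ⊓ mk b := rfl

instance : IsModularLattice D222 where
  sup_inf_le_assoc_of_le {a} b {c} h := by
    obtain ⟨a, rfl⟩ := mk_surj a; obtain ⟨b, rfl⟩ := mk_surj b; obtain ⟨c, rfl⟩ := mk_surj c
    exact Poly.Le.modular b (mk_le_mk.1 h)

/-- The unit `I`. -/
instance : OrderTop D222 where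
  top := mk Poly.one
  le_top a := by
    obtain ⟨a, rfl⟩ := mk_surj a
    exact Poly.Le.le_one a

theorem mk_one : mk Poly.one = ⊤ := rfl

/-- The generator `x_i`. -/
def x (i : Fin 3) : D222 := mk (Poly.x i)

/-- The generator `y_i`. -/
def y (i : Fin 3) : D222 := mk (Poly.y i)

theorem x_le_y (i : Fin 3) : x i ≤ y i := Poly.Le.x_le_y i

theorem x_inf_le (i : Fin 3) : x 0 ⊓ x 1 ⊓ x 2 ≤ x i := by
  fin_cases i
  · exact inf_le_left.trans inf_le_left
  · exact inf_le_left.trans inf_le_right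
  · exact inf_le_right

/-- Since there are finitely many generators, `D^{2,2,2}` has a least element, `x_1 x_2 x_3`. It is
only used as the value of an empty sum. -/
instance : OrderBot D222 where
  bot := x 0 ⊓ x 1 ⊓ x 2
  bot_le a := by
    obtain ⟨p, rfl⟩ := mk_surj a
    induction p with
    | x i => exact x_inf_le i
    | y i => exact (x_inf_le i).trans (x_le_y i)
    | one => exact le_top
    | sum a b ha _ => exact ha.trans (Poly.Le.le_sum_left a b)
    | meet a b ha hb => exact le_inf ha hb

section Lift

variable {L : Type w} [Lattice L] [IsModularLattice L] [OrderTop L]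

/-- The value of a polynomial in a modular lattice with a greatest element. -/
def eval (X Y : Fin 3 → L) : Poly → L
  | .x i => X i
  | .y i => Y i
  | .one => ⊤
  | .sum a b => eval X Y a ⊔ eval X Y b
  | .meet a b => eval X Y a ⊓ eval X Y b

theorem eval_mono {X Y : Fin 3 → L} (h : ∀ i, X i ≤ Y i) {a b : Poly} (hab : Poly.Le a b) :
    eval X Y a ≤ eval X Y b := by
  induction hab with
  | refl a => exact le_rfl
  | trans _ _ h₁ h₂ => exact h₁.trans h₂
  | le_sum_left a b => exact le_sup_left
  | le_sum_right a b => exact le_sup_right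
  | sum_le _ _ h₁ h₂ => exact sup_le h₁ h₂
  | meet_le_left a b => exact inf_le_left
  | meet_le_right a b => exact inf_le_right
  | le_meet _ _ h₁ h₂ => exact le_inf h₁ h₂
  | modular b _ h₁ => exact IsModularLattice.sup_inf_le_assoc_of_le _ h₁
  | le_one a => exact le_top
  | x_le_y i => exact h i

/-- The universal property of `D^{2,2,2}`: elements `X_i ≤ Y_i` of a modular lattice with a
greatest element extend to a lattice homomorphism. -/
def lift (X Y : Fin 3 → L) (h : ∀ i, X i ≤ Y i) : LatticeHom D222 L where
  toFun := Quotient.lift (eval X Y) (fun _ _ hab =>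
    le_antisymm (eval_mono h hab.1) (eval_mono h hab.2))
  map_sup' a b := by
    obtain ⟨a, rfl⟩ := mk_surj a; obtain ⟨b, rfl⟩ := mk_surj b
    rfl
  map_inf' a b := by
    obtain ⟨a, rfl⟩ := mk_surj a; obtain ⟨b, rfl⟩ := mk_surj b
    rfl

theorem lift_x (X Y : Fin 3 → L) (h : ∀ i, X i ≤ Y i) (i : Fin 3) : lift X Y h (x i) = X i := rfl

theorem lift_y (X Y : Fin 3 → L) (h : ∀ i, X i ≤ Y i) (i : Fin 3) : lift X Y h (y i) = Y i := rfl

theorem lift_top (X Y : Fin 3 → L) (h : ∀ i, X i ≤ Y i) : lift X Y h ⊤ = ⊤ := rfl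

end Lift

end D222

open D222

/-! ### Representations, the Coxeter functor and the elementary maps -/

/-- A linear representation of `D^{2,2,2}` in the vector space `V`: a lattice homomorphism to the
lattice of subspaces that sends the unit to the whole space. -/
structure Rep (K : Type u) (V : Type v) [Field K] [AddCommGroup V] [Module K V] where
  hom : LatticeHom D222 (Submodule K V)
  map_top : hom ⊤ = ⊤

namespace Rep

variable {K : Type u} {V : Type v} [Field K] [AddCommGroup V] [Module K V]

instance : CoeFun (Rep K V) (fun _ => D222 → Submodule K V) := ⟨fun ρ => ρ.hom⟩

/-- A representation is indecomposable if `V ≠ 0` and `ρ` is not a direct sum of representations in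
two nonzero subspaces. -/
def Indecomposable (ρ : Rep K V) : Prop :=
  Nontrivial V ∧ ∀ U W : Submodule K V, IsCompl U W →
    (∀ a : D222, ρ a = (ρ a ⊓ U) ⊔ (ρ a ⊓ W)) → U = ⊥ ∨ W = ⊥

/-- The space `X_0^1 = {(η_1, η_2, η_3) | η_i ∈ ρ(y_i), η_1 + η_2 + η_3 = 0}`. -/
def space (ρ : Rep K V) : Submodule K (Fin 3 → V) where
  carrier := {η | (∀ i, η i ∈ ρ (y i)) ∧ ∑ i, η i = 0}
  zero_mem' := ⟨fun i => (ρ (y i)).zero_mem, by simp⟩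
  add_mem' {a b} ha hb :=
    ⟨fun i => (ρ (y i)).add_mem (ha.1 i) (hb.1 i), by
      simp [Finset.sum_add_distrib, ha.2, hb.2]⟩
  smul_mem' c a ha :=
    ⟨fun i => (ρ (y i)).smul_mem c (ha.1 i), by
      simp [← Finset.smul_sum, ha.2]⟩

/-- The elementary map `φ_i : X_0^1 → V`, `(η_1, η_2, η_3) ↦ η_i`. -/
def phi (ρ : Rep K V) (i : Fin 3) : ρ.space →ₗ[K] V :=
  (LinearMap.proj i).comp ρ.space.subtype

/-- The representation `Φ⁺ρ` in `X_0^1`: its subspaces `Y_i^1` and `X_i^1` consist of the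
`(η_1, η_2, η_3)` with `η_i ∈ ρ(x_i)` and with `η_i = 0`, respectively. -/
def coxeter (ρ : Rep K V) : Rep K ρ.space where
  hom := lift (fun i => (⊥ : Submodule K V).comap (ρ.phi i)) (fun i => (ρ (x i)).comap (ρ.phi i))
    (fun _ => Submodule.comap_mono bot_le)
  map_top := rfl

/-- The subspace `φ_1 Φ⁺ρ(a) + φ_2 Φ⁺ρ(a) + φ_3 Φ⁺ρ(a)` of `V`. -/
def sumPhi (ρ : Rep K V) (a : D222) : Submodule K V :=
  ⨆ k : Fin 3, (ρ.coxeter a).map (ρ.phi k)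

end Rep

/-- An element of `D^{2,2,2}` is perfect (over the field `K`) if every finite-dimensional
indecomposable representation sends it to `0` or to the whole space. -/
def IsPerfect (K : Type u) [Field K] (a : D222) : Prop :=
  ∀ (V : Type v) [AddCommGroup V] [Module K V] [FiniteDimensional K V] (ρ : Rep K V),
    ρ.Indecomposable → ρ a = ⊥ ∨ ρ a = ⊤

/-! ### Atomic elements -/

/-- The third index `k`, `{i, j, k} = {1, 2, 3}`, for distinct `i`, `j`. -/
def third (i j : Fin 3) : Fin 3 := -(i + j)

/-- The atomic elements `a_n^{ij} = x_i + y_j a_{n-1}^{jk}`, `a_0^{ij} = I`. -/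
def atomA : ℕ → Fin 3 → Fin 3 → D222
  | 0, _, _ => ⊤
  | n + 1, i, j => x i ⊔ y j ⊓ atomA n j (third i j)

/-- The atomic elements `A_n^{ij} = y_i + x_j A_{n-1}^{ki}`, `A_0^{ij} = I`. -/
def atomB : ℕ → Fin 3 → Fin 3 → D222
  | 0, _, _ => ⊤
  | n + 1, i, j => y i ⊔ x j ⊓ atomB n (third i j) i

/-! ### Admissible sequences

The sequence `i_n … i_2 i_1` is the list `[i_n, …, i_2, i_1]`. -/

/-- Adjacent indices are distinct. -/
def Admissible (α : List (Fin 3)) : Prop := α.IsChain (· ≠ ·)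

instance : DecidablePred Admissible := fun α => inferInstanceAs (Decidable (α.IsChain (· ≠ ·)))

/-- The replacement of a subsequence `i j i` by `i k i`. -/
inductive Move : List (Fin 3) → List (Fin 3) → Prop
  | replace (u w : List (Fin 3)) (i j k : Fin 3) (hij : i ≠ j) (hik : i ≠ k) (hjk : j ≠ k) :
      Move (u ++ i :: j :: i :: w) (u ++ i :: k :: i :: w)

/-- Admissible sequences are identified if replacements `i j i ↦ i k i` take one to the other. -/
abbrev SeqEquiv : List (Fin 3) → List (Fin 3) → Prop := Relation.EqvGen Move

/-- The normal forms of admissible sequences. Write `i = 1, j = 2, k = 3` up to a permutation. -/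
inductive NormalForm : Type
  /-- `1(21)^n`, with `1 = i` and `2 = i + 1`; the same sequence as `1(31)^n`. -/
  | alt (i : Fin 3) (n : ℕ) : NormalForm
  /-- `(213)^m(21)^n`, `3(213)^m(21)^n`, `13(213)^m(21)^n` for `r = 0, 1, 2`; here `n ≥ 1`. -/
  | chain (i j : Fin 3) (r : Fin 3) (m n : ℕ) : NormalForm

namespace NormalForm

/-- The sequence `β^n`. -/
def power (β : List (Fin 3)) (n : ℕ) : List (Fin 3) := (List.replicate n β).flatten

/-- The sequence written by a normal form. -/
def word : NormalForm → List (Fin 3)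
  | alt i n => i :: power [i + 1, i] n
  | chain i j r m n =>
    ![[], [third i j], [i, third i j]] r ++ (power [j, i, third i j] m ++ power [j, i] n)

/-- The normal form of the sequence `cα`, where `c` differs from the first index of `α`, in terms
of the normal form of `α`. -/
def step (c : Fin 3) : NormalForm → NormalForm
  | alt i n => chain i c 0 0 (n + 1)
  | chain i j r m n =>
    if r = 0 then
      if c = i then
        if m = 0 then alt i n else chain i j 2 (m - 1) (n + 1)
      else chain i j 1 m n
    else if r = 1 then
      if c = i then chain i j 2 m n else chain i j 0 m (n + 1)
    else
      if c = j then chain i j 0 (m + 1) n else chain i j 1 m (n + 1)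

/-- The normal form of an admissible sequence; `ofSeq_spec` and `ofSeq_move` show that it is
equivalent to the sequence and depends only on its class (the empty sequence gets a dummy value). -/
def ofSeq : List (Fin 3) → NormalForm
  | [] => alt 0 0
  | [t] => alt t 0
  | c :: d :: α => step c (ofSeq (d :: α))

theorem seqEquiv_append (u w : List (Fin 3)) {α β : List (Fin 3)} (h : SeqEquiv α β) :
    SeqEquiv (u ++ α ++ w) (u ++ β ++ w) := by
  induction h with
  | rel a b h =>
    obtain ⟨u', w', i, j, k, h1, h2, h3⟩ := h
    have := Move.replace (u ++ u') (w' ++ w) i j k h1 h2 h3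
    simpa using Relation.EqvGen.rel _ _ this
  | refl a => exact .refl _
  | symm a b _ ih => exact .symm _ _ ih
  | trans a b c _ _ h1 h2 => exact .trans _ _ _ h1 h2

theorem seqEquiv_prefix (u : List (Fin 3)) {α β : List (Fin 3)} (h : SeqEquiv α β) :
    SeqEquiv (u ++ α) (u ++ β) := by
  simpa using seqEquiv_append u [] h

theorem seqEquiv_cons (c : Fin 3) {α β : List (Fin 3)} (h : SeqEquiv α β) :
    SeqEquiv (c :: α) (c :: β) := seqEquiv_prefix [c] h

theorem seqEquiv_flip (w : List (Fin 3)) {i j k : Fin 3} (hij : i ≠ j) (hik : i ≠ k)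
    (hjk : j ≠ k) : SeqEquiv (i :: j :: i :: w) (i :: k :: i :: w) :=
  .rel _ _ (Move.replace [] w i j k hij hik hjk)

theorem power_succ (β : List (Fin 3)) (n : ℕ) : power β (n + 1) = β ++ power β n := by
  simp [power, List.replicate_succ]

theorem power_zero (β : List (Fin 3)) : power β 0 = [] := by
  simp [power]

theorem alt_equiv {i j k : Fin 3} (hij : i ≠ j) (hik : i ≠ k) (n : ℕ) :
    SeqEquiv (i :: power [j, i] n) (i :: power [k, i] n) := by
  by_cases hjk : j = k
  · subst hjk; exact .refl _
  induction n with
  | zero => simpa [power_zero] using Relation.EqvGen.refl _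
  | succ n ih =>
    simp only [power_succ, List.cons_append, List.nil_append]
    exact .trans _ _ _ (seqEquiv_flip _ hij hik hjk) (seqEquiv_cons _ (seqEquiv_cons _ ih))

theorem ne_add_one (i : Fin 3) : i ≠ i + 1 := by
  revert i; decide

theorem fin3_cases (r : Fin 3) : r = 0 ∨ r = 1 ∨ r = 2 := by
  revert r; decide

theorem third_ne {i j : Fin 3} (h : i ≠ j) : i ≠ third i j ∧ j ≠ third i j := by
  revert i j; decide

theorem eq_third {i j c : Fin 3} (h : i ≠ j) (hi : c ≠ i) (hj : c ≠ j) : c = third i j := by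
  revert i j c; decide

theorem chain_equiv₁ {i j l : Fin 3} (hij : i ≠ j) (hil : i ≠ l) (hjl : j ≠ l) (m n : ℕ) :
    SeqEquiv (i :: (power [j, i, l] (m + 1) ++ power [j, i] (n + 1)))
      (i :: l :: (power [j, i, l] m ++ power [j, i] (n + 2))) := by
  have key : ∀ w, SeqEquiv (i :: j :: i :: l :: j :: w) (i :: l :: j :: i :: j :: w) := fun w =>
    .trans _ _ _ (seqEquiv_flip _ hij hil hjl) (.trans _ _ _
      (seqEquiv_cons i (seqEquiv_flip _ hil.symm hjl.symm hij))
      (seqEquiv_prefix [i, l] (seqEquiv_flip _ hjl hij.symm hil.symm)))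
  induction m with
  | zero =>
    simp only [power_succ, power_zero, List.cons_append, List.nil_append]
    exact key _
  | succ m ih =>
    rw [power_succ _ (m + 1), power_succ _ m] at *
    simp only [List.cons_append, List.nil_append] at *
    exact .trans _ _ _ (key _) (seqEquiv_prefix [i, l, j] ih)

theorem chain_equiv₂ {i j l : Fin 3} (hij : i ≠ j) (hil : i ≠ l) (hjl : j ≠ l) (m n : ℕ) :
    SeqEquiv (j :: l :: (power [j, i, l] m ++ power [j, i] (n + 1)))
      (power [j, i, l] m ++ power [j, i] (n + 2)) := by
  induction m with
  | zero =>
    simp only [power_succ, power_zero, List.cons_append, List.nil_append]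
    exact seqEquiv_flip _ hjl hij.symm hil.symm
  | succ m ih =>
    rw [power_succ _ m]
    simp only [List.cons_append, List.nil_append]
    exact .trans _ _ _ (seqEquiv_flip _ hjl hij.symm hil.symm) (.trans _ _ _
      (seqEquiv_cons j (seqEquiv_flip _ hij hil hjl)) (.trans _ _ _
      (seqEquiv_prefix [j, i] (seqEquiv_flip _ hil.symm hjl.symm hij))
      (seqEquiv_prefix [j, i, l] ih)))

/-- The normal forms that occur. -/
def Valid : NormalForm → Prop
  | alt _ _ => True
  | chain i j _ _ n => i ≠ j ∧ 1 ≤ n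

/-- The first index of a normal form. -/
def lead : NormalForm → Fin 3
  | alt i _ => i
  | chain i j r _ _ => ![j, third i j, i] r

theorem step_spec {c : Fin 3} {F : NormalForm} (hF : F.Valid) (hc : c ≠ F.lead) :
    (step c F).Valid ∧ (step c F).lead = c ∧ SeqEquiv (step c F).word (c :: F.word) := by
  cases F with
  | alt i n =>
    have hc' : c ≠ i := hc
    refine ⟨⟨hc'.symm, by omega⟩, rfl, ?_⟩
    simp only [step, word, power_succ, power_zero, List.cons_append, List.nil_append,
      Matrix.cons_val_zero]
    exact seqEquiv_cons _ (alt_equiv hc'.symm (ne_add_one i) n)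
  | chain i j r m n =>
    obtain ⟨hij, hn⟩ := hF
    obtain ⟨n, rfl⟩ : ∃ k, n = k + 1 := ⟨n - 1, by omega⟩
    obtain ⟨hil, hjl⟩ := third_ne hij
    rcases fin3_cases r with rfl | rfl | rfl
    · have hc' : c ≠ j := hc
      by_cases hci : c = i
      · subst hci
        rcases m with _ | m
        · simp only [step, if_true]
          refine ⟨trivial, rfl, ?_⟩
          simpa [word, power_zero] using alt_equiv (ne_add_one _) hij (n + 1)
        · simp only [step, if_true, Nat.add_one_ne_zero, if_false]
          refine ⟨⟨hij, by omega⟩, rfl, ?_⟩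
          exact .symm _ _ (chain_equiv₁ hij hil hjl m n)
      · simp only [step, if_true, if_neg hci]
        obtain rfl := eq_third hij hci hc'
        exact ⟨⟨hij, by omega⟩, rfl, .refl _⟩
    · have hc' : c ≠ third i j := hc
      by_cases hci : c = i
      · subst hci
        simp only [step, if_true, one_ne_zero, if_false]
        exact ⟨⟨hij, by omega⟩, rfl, .refl _⟩
      · have hcj : c = j := by
          by_contra h
          exact hc' (eq_third hij hci h)
        subst hcj
        simp only [step, if_true, one_ne_zero, if_false, if_neg hci]
        refine ⟨⟨hij, by omega⟩, rfl, ?_⟩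
        exact .symm _ _ (chain_equiv₂ hij hil hjl m n)
    · have hc' : c ≠ i := hc
      have h20 : (2 : Fin 3) ≠ 0 := by decide
      have h21 : (2 : Fin 3) ≠ 1 := by decide
      by_cases hcj : c = j
      · subst hcj
        simp only [step, if_true, if_neg h20, if_neg h21]
        refine ⟨⟨hij, by omega⟩, rfl, ?_⟩
        simp only [word, power_succ, List.cons_append, List.nil_append, Matrix.cons_val_zero,
          Matrix.cons_val]
        exact .refl _
      · simp only [step, if_neg h20, if_neg h21, if_neg hcj]
        obtain rfl := eq_third hij hc' hcj
        refine ⟨⟨hij, by omega⟩, rfl, ?_⟩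
        exact .symm _ _ (.trans _ _ _ (seqEquiv_flip _ hil.symm hjl.symm hij)
          (seqEquiv_cons _ (chain_equiv₂ hij hil hjl m n)))

/-- The normal form of an admissible sequence is equivalent to it. -/
theorem ofSeq_spec (c : Fin 3) (α : List (Fin 3)) (h : Admissible (c :: α)) :
    (ofSeq (c :: α)).Valid ∧ (ofSeq (c :: α)).lead = c ∧
      SeqEquiv (ofSeq (c :: α)).word (c :: α) := by
  induction α generalizing c with
  | nil => exact ⟨trivial, rfl, .refl _⟩
  | cons d α ih =>
    have h' : c ≠ d ∧ Admissible (d :: α) := List.isChain_cons_cons.1 h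
    obtain ⟨h1, h2, h3⟩ := ih d h'.2
    obtain ⟨h4, h5, h6⟩ := step_spec (c := c) h1 (by rw [h2]; exact h'.1)
    exact ⟨h4, h5, .trans _ _ _ h6 (seqEquiv_cons c h3)⟩

/-- The normal form with exponent `n + 1` in place of `n`. -/
def bump : NormalForm → NormalForm
  | alt i n => alt i (n + 1)
  | chain i j r m n => chain i j r m (n + 1)

theorem step_step {c : Fin 3} {F : NormalForm} (hF : F.Valid) (hc : c ≠ F.lead) :
    step F.lead (step c F) = F.bump := by
  cases F with
  | alt i n =>
    simp [step, lead, bump]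
  | chain i j r m n =>
    obtain ⟨hij, hn⟩ := hF
    obtain ⟨hil, hjl⟩ := third_ne hij
    have hcc : c = i ∨ c = j ∨ c = third i j := by
      by_cases h : c = i
      · exact .inl h
      by_cases h' : c = j
      · exact .inr (.inl h')
      exact .inr (.inr (eq_third hij h h'))
    rcases fin3_cases r with rfl | rfl | rfl <;> rcases hcc with rfl | rfl | rfl <;>
      rcases m with _ | m <;>
      simp_all [step, lead, bump, Ne.symm hij, Ne.symm hil, Ne.symm hjl]

theorem ofSeq_step (c d : Fin 3) (α : List (Fin 3)) :
    ofSeq (c :: d :: α) = step c (ofSeq (d :: α)) := rfl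

/-- The normal form depends only on the class of the admissible sequence. -/
theorem ofSeq_move {α β : List (Fin 3)} (h : Move α β) (hα : Admissible α) :
    Admissible β ∧ ofSeq α = ofSeq β := by
  obtain ⟨u, w, i, j, k, hij, hik, hjk⟩ := h
  induction u with
  | nil =>
    have h1 : Admissible (i :: w) := (List.isChain_cons_cons.1 (List.isChain_cons_cons.1 hα).2).2
    refine ⟨List.isChain_cons_cons.2 ⟨hik, List.isChain_cons_cons.2 ⟨hik.symm, h1⟩⟩, ?_⟩
    obtain ⟨h2, h3, -⟩ := ofSeq_spec i w h1
    have h4 := step_step (c := j) h2 (by rw [h3]; exact hij.symm)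
    have h5 := step_step (c := k) h2 (by rw [h3]; exact hik.symm)
    rw [h3] at h4 h5
    simp only [List.nil_append, ofSeq_step, h4, h5]
  | cons c u ih =>
    have h1 : Admissible (u ++ i :: j :: i :: w) := List.IsChain.tail hα
    obtain ⟨h2, h3⟩ := ih h1
    cases u with
    | nil =>
      have h4 : c ≠ i := (List.isChain_cons_cons.1 hα).1
      exact ⟨List.isChain_cons_cons.2 ⟨h4, h2⟩, congrArg (step c) h3⟩
    | cons d u =>
      have h4 : c ≠ d := (List.isChain_cons_cons.1 hα).1
      exact ⟨List.isChain_cons_cons.2 ⟨h4, h2⟩, congrArg (step c) h3⟩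

/-- The element `f_α` for a sequence `α` in normal form. -/
def f : NormalForm → D222
  | alt i n =>
    let j := i + 1
    let l := i + 2
    let k := n / 2
    if n % 2 = 0 then x i ⊓ atomB k j l ⊓ atomA k j l
    else y i ⊓ (x j ⊔ x l) ⊓ atomB k l i ⊓ atomA k i j
  | chain i j r m n =>
    let l := third i j
    let p := m / 2
    let k := n / 2
    let q := k + 3 * p
    if n % 2 = 0 then
      if m % 2 = 0 then
        ![y i ⊓ y j ⊓ atomA q i l ⊓ atomB (k - 1) l j,
          y l ⊓ (x i ⊔ x j) ⊓ atomB q j l ⊓ atomA (k - 1) l i,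
          y l ⊓ y i ⊓ atomA (q + 1) l j ⊓ atomB (k - 1) j i] r
      else
        ![y j ⊓ (x l ⊔ x i) ⊓ atomB (q + 1) i j ⊓ atomA (k - 1) j l,
          y j ⊓ y l ⊓ atomA (q + 2) j i ⊓ atomB (k - 1) i l,
          y i ⊓ (x j ⊔ x l) ⊓ atomB (q + 2) l i ⊓ atomA (k - 1) i j] r
    else
      if m % 2 = 0 then
        ![y j ⊓ y l ⊓ atomA q j i ⊓ atomB k i l,
          x l ⊓ atomB (q + 1) i j ⊓ atomA k i j,
          y i ⊓ y j ⊓ atomA (q + 1) i l ⊓ atomB k l j] r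
      else
        ![x j ⊓ atomB (q + 2) l i ⊓ atomA k l i,
          y l ⊓ y i ⊓ atomA (q + 2) l j ⊓ atomB k j i,
          x i ⊓ atomB (q + 3) j l ⊓ atomA k j l] r

/-- The element `e_α` for a sequence `α` in normal form. -/
def e : NormalForm → D222
  | alt i n =>
    let j := i + 1
    let l := i + 2
    let k := n / 2
    if n % 2 = 0 then y i ⊓ atomB k l i ⊓ atomA k i j ⊓ atomB k j l ⊓ atomA k j l
    else y i ⊓ atomB k l i ⊓ atomA k i j ⊓ atomB (k + 1) j l ⊓ atomA (k + 1) j l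
  | chain i j r m n =>
    let l := third i j
    let p := m / 2
    let k := n / 2
    let q := k + 3 * p
    if n % 2 = 0 then
      if m % 2 = 0 then
        ![y j ⊓ atomB (k - 1) l j ⊓ atomA q j i ⊓ atomB k i l ⊓ atomA q i l,
          y l ⊓ atomA (k - 1) l i ⊓ atomB (q + 1) i j ⊓ atomA k i j ⊓ atomB q j l,
          y i ⊓ atomB (k - 1) j i ⊓ atomA (q + 1) i l ⊓ atomB k l j ⊓ atomA (q + 1) l j] r
      else
        ![y j ⊓ atomA (k - 1) j l ⊓ atomB (q + 2) l i ⊓ atomA k l i ⊓ atomB (q + 1) i j,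
          y l ⊓ atomB (k - 1) i l ⊓ atomA (q + 2) l j ⊓ atomB k j i ⊓ atomA (q + 2) j i,
          y i ⊓ atomA (k - 1) i j ⊓ atomB (q + 3) j l ⊓ atomA k j l ⊓ atomB (q + 2) l i] r
    else
      if m % 2 = 0 then
        ![y j ⊓ atomB k l j ⊓ atomA q j i ⊓ atomB k i l ⊓ atomA (q + 1) i l,
          y l ⊓ atomA k l i ⊓ atomB (q + 1) i j ⊓ atomA k i j ⊓ atomB (q + 1) j l,
          y i ⊓ atomB k j i ⊓ atomA (q + 1) i l ⊓ atomB k l j ⊓ atomA (q + 2) l j] r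
      else
        ![y j ⊓ atomA k j l ⊓ atomB (q + 2) l i ⊓ atomA k l i ⊓ atomB (q + 2) i j,
          y l ⊓ atomB k i l ⊓ atomA (q + 2) l j ⊓ atomB k j i ⊓ atomA (q + 3) j i,
          y i ⊓ atomA k i j ⊓ atomB (q + 3) j l ⊓ atomA k j l ⊓ atomB (q + 3) l i] r

end NormalForm

/-- The admissible element `f_α`. -/
def admF (α : List (Fin 3)) : D222 := (NormalForm.ofSeq α).f

/-- The admissible element `e_α`. -/
def admE (α : List (Fin 3)) : D222 := (NormalForm.ofSeq α).e

/-! ### Cumulative polynomials and the elements `a_i(n)`, `b_i(n)`, `c_i(n)` -/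

/-- The admissible sequences `i_n … i_2 t` of length `n`. -/
def admSeqs (t : Fin 3) (n : ℕ) : Finset (List.Vector (Fin 3) n) :=
  Finset.univ.filter fun α => Admissible α.toList ∧ α.toList.getLast? = some t

/-- The cumulative polynomial `x_t(n)`, the sum of all `f_α` with `α = i_n … i_2 t`. -/
def cumX (t : Fin 3) (n : ℕ) : D222 := (admSeqs t n).sup fun α => admF α.toList

/-- The cumulative polynomial `y_t(n)`, the sum of all `e_α` with `α = i_n … i_2 t`. -/
def cumY (t : Fin 3) (n : ℕ) : D222 := (admSeqs t n).sup fun α => admE α.toList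

/-- The elements `a_i(n)`; the two other indices are `i + 1` and `i + 2` in `Fin 3`. -/
def elemA (i : Fin 3) : ℕ → D222
  | 0 => y (i + 1) ⊔ y (i + 2)
  | n + 1 => cumX (i + 1) (n + 1) ⊔ cumX (i + 2) (n + 1) ⊔
      cumY (i + 1) (n + 2) ⊔ cumY (i + 2) (n + 2)

/-- The elements `b_i(n)`. -/
def elemB (i : Fin 3) : ℕ → D222
  | 0 => x i ⊔ y (i + 1) ⊔ y (i + 2)
  | n + 1 => elemA i (n + 1) ⊔ cumX i (n + 2)

/-- The elements `c_i(n)`. -/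
def elemC (i : Fin 3) : ℕ → D222
  | 0 => y 0 ⊔ y 1 ⊔ y 2
  | n + 1 => elemA i (n + 1) ⊔ cumY i (n + 2)

end Sextuple

/-!
The proof rests on one observation about the representation `Φ⁺ρ`. Let `{i, j, l} = {1, 2, 3}`.
In `Φ⁺ρ` the atomic elements are preimages of atomic elements of `ρ` under the elementary maps:
`η` lies in `a_n^{ij}` if and only if `η_i ∈ ρ(A_n^{lj})` (`Rep.mem_coxeter_atomA`), and `η` lies in
`A_n^{ij}` if and only if `η_i ∈ ρ(a_n^{il})` (`Rep.mem_coxeter_atomB`). Since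
`η_1 + η_2 + η_3 = 0`, the first condition may be read at `η_j` instead of `η_i`, and so may the
second one when `η_l ∈ ρ(x_l)`. Hence applying `φ_c` to an intersection of generators and atomic
elements means deciding, for a given `η_c`, whether the two other components can be chosen in given
subspaces, and this is a condition `η_c ∈ ρ(a + b)` (`Rep.exists_space_iff`).

Up to the values of the exponents and the order of the indices, every `e_α` has one of the two
shapes `evenE`, `oddE`, and every `f_α` one of the three shapes `evenF`, `oddF`, `oddX`, according
to the parity of the length of `α`. The observation above shows that the elementary maps permute
these shapes and yields `φ_c Φ⁺ρ(f_α) = ρ(f_{cα})` and `φ_c Φ⁺ρ(e_α) = ρ(e_{cα})` for every `c`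
different from the first index of `α` (`Rep.step_f`, `Rep.step_e`). The elements of `1(21)^n` and
`1(31)^n` have to be compared for this; they agree because `φ_i φ_j = -φ_i φ_l` on the part of
`Φ⁺Φ⁺ρ` that lies in `Y_i` (`Rep.image_image_le`). As `φ_1 + φ_2 + φ_3 = 0`, the image under the
third elementary map, the one of the first index of `α`, adds nothing to the sum of the other two.
Summation over `α` (`Rep.sumPhi_cum`) gives the recursion for `a_i(n)`, `b_i(n)`, `c_i(n)`.

For perfection, a subspace that contains two of the `Y_i` has a complement compatible with the
chain formed by the third pair `X_i ≤ Y_i`; so an indecomposable representation has no such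
subspace except possibly `0` and the whole space
(`Rep.Indecomposable.eq_bot_or_eq_top`). This proves perfection of `a_i(0)`, `b_i(0)`, `c_i(0)`,
and it shows that in an indecomposable representation either two of the `Y_i` vanish, and with them
`Φ⁺ρ`, or any two `Y_i` span the space. In the second case `Φ⁺ρ` is indecomposable
(`Rep.Indecomposable.coxeter`) and `∑ φ_k` maps its whole space onto the space of `ρ`, so perfection
is passed on along the recursion. The first step of the recursion has the additional summands `x_j`
and `x_l` (`Rep.elemA_one`). They are harmless: if any two `Y_i` span the space and the preceding
term of the recursion vanishes on `Φ⁺ρ`, then `ρ(x_j) = ρ(x_l) = 0`; and if two of the `Y_i`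
vanish, then every `ρ(x_s)` is `0` or the whole space.
-/

/-! ### The atomic elements of `Φ⁺ρ` -/

namespace Sextuple

open D222

/-- `i`, `j`, `l` are the three indices in some order. -/
structure Triple (i j l : Fin 3) : Prop where
  ij : i ≠ j
  il : i ≠ l
  jl : j ≠ l

namespace Triple

variable {i j l : Fin 3}

theorem rotate (h : Triple i j l) : Triple j l i := ⟨h.jl, h.ij.symm, h.il.symm⟩

theorem swap (h : Triple i j l) : Triple j i l := ⟨h.ij.symm, h.jl, h.il⟩

theorem third_eq (h : Triple i j l) : third i j = l :=
  (NormalForm.eq_third h.ij h.il.symm h.jl.symm).symm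

theorem of_ne (h : i ≠ j) : Triple i j (third i j) :=
  ⟨h, (NormalForm.third_ne h).1, (NormalForm.third_ne h).2⟩

theorem eq_or (h : Triple i j l) (s : Fin 3) : s = i ∨ s = j ∨ s = l := by
  obtain ⟨h1, h2, h3⟩ := h
  revert i j l s
  decide

theorem sum_eq {M : Type*} [AddCommMonoid M] (h : Triple i j l) (g : Fin 3 → M) :
    ∑ s, g s = g i + g j + g l := by
  have : (Finset.univ : Finset (Fin 3)) = {i, j, l} := by
    ext s; simpa using h.eq_or s
  rw [this, Finset.sum_insert (by simp [h.ij, h.il]), Finset.sum_insert (by simp [h.jl]),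
    Finset.sum_singleton, add_assoc]

theorem atomA_succ (h : Triple i j l) (n : ℕ) : atomA (n + 1) i j = x i ⊔ y j ⊓ atomA n j l := by
  rw [atomA, h.third_eq]

theorem atomB_succ (h : Triple i j l) (n : ℕ) : atomB (n + 1) i j = y i ⊔ x j ⊓ atomB n l i := by
  rw [atomB, h.third_eq]

theorem x_le_atomA_left (h : Triple i j l) (n : ℕ) : x i ≤ atomA n i j := by
  cases n with
  | zero => exact le_top
  | succ n => exact h.atomA_succ n ▸ le_sup_left

theorem x_le_atomA_right (h : Triple i j l) (n : ℕ) : x j ≤ atomA n i j := by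
  cases n with
  | zero => exact le_top
  | succ n =>
    exact h.atomA_succ n ▸ le_sup_of_le_right (le_inf (x_le_y j) (h.rotate.x_le_atomA_left n))

theorem y_le_atomB (h : Triple i j l) (n : ℕ) : y i ≤ atomB n i j := by
  cases n with
  | zero => exact le_top
  | succ n => exact h.atomB_succ n ▸ le_sup_left

end Triple

namespace Rep

variable {K : Type u} {V : Type v} [Field K] [AddCommGroup V] [Module K V] (ρ : Rep K V)
  {i j l : Fin 3}

theorem hom_mono {a b : D222} (h : a ≤ b) : ρ a ≤ ρ b := OrderHomClass.mono ρ.hom h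

theorem mem_of_le {a b : D222} (h : a ≤ b) {v : V} (hv : v ∈ ρ a) : v ∈ ρ b := ρ.hom_mono h hv

theorem mem_inf {a b : D222} {v : V} : v ∈ ρ (a ⊓ b) ↔ v ∈ ρ a ∧ v ∈ ρ b := by
  rw [map_inf, Submodule.mem_inf]

theorem mem_sup {a b : D222} {v : V} : v ∈ ρ (a ⊔ b) ↔ ∃ s ∈ ρ a, ∃ t ∈ ρ b, s + t = v := by
  rw [map_sup, Submodule.mem_sup]

theorem mem_top (v : V) : v ∈ ρ ⊤ := by rw [ρ.map_top]; trivial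

theorem space_mem (η : ρ.space) (s : Fin 3) : η.1 s ∈ ρ (y s) := η.2.1 s

theorem space_sum (h : Triple i j l) (η : ρ.space) : η.1 i + η.1 j + η.1 l = 0 := by
  rw [← h.sum_eq η.1]; exact η.2.2

theorem exists_space (h : Triple i j l) {a b c : V} (ha : a ∈ ρ (y i)) (hb : b ∈ ρ (y j))
    (hc : c ∈ ρ (y l)) (hs : a + b + c = 0) :
    ∃ η : ρ.space, η.1 i = a ∧ η.1 j = b ∧ η.1 l = c := by
  let g : Fin 3 → V := fun s => if s = i then a else if s = j then b else c
  have gi : g i = a := if_pos rfl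
  have gj : g j = b := by simp [g, h.ij.symm]
  have gl : g l = c := by simp [g, h.il.symm, h.jl.symm]
  refine ⟨⟨g, fun s => ?_, by rw [h.sum_eq, gi, gj, gl, hs]⟩, gi, gj, gl⟩
  rcases h.eq_or s with rfl | rfl | rfl
  · rwa [gi]
  · rwa [gj]
  · rwa [gl]

theorem mem_coxeter_x {η : ρ.space} : η ∈ ρ.coxeter (x i) ↔ η.1 i = 0 := Iff.rfl

theorem mem_coxeter_y {η : ρ.space} : η ∈ ρ.coxeter (y i) ↔ η.1 i ∈ ρ (x i) := Iff.rfl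

theorem mem_iff_mem_of_add_eq_zero {p : Submodule K V} {a b c : V} (hs : a + b + c = 0)
    (hc : c ∈ p) : a ∈ p ↔ b ∈ p := by
  have h1 : a = -(b + c) := by rw [← add_eq_zero_iff_eq_neg, ← hs]; abel
  rw [h1, p.neg_mem_iff, p.add_mem_iff_left hc]

/-- The atomic element `a_n^{ij}` of `Φ⁺ρ` is the preimage of `A_n^{lj}` under `φ_i`. -/
theorem mem_coxeter_atomA (h : Triple i j l) {n : ℕ} {η : ρ.space} :
    η ∈ ρ.coxeter (atomA n i j) ↔ η.1 i ∈ ρ (atomB n l j) := by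
  induction n generalizing i j l η with
  | zero => exact iff_of_true (ρ.coxeter.mem_top _) (ρ.mem_top _)
  | succ n ih =>
    rw [h.atomA_succ, h.rotate.swap.atomB_succ, mem_sup, mem_sup]
    constructor
    · rintro ⟨ζ, hζ, θ, hθ, rfl⟩
      rw [mem_inf, ih h.rotate] at hθ
      have hs := ρ.space_sum h θ
      refine ⟨-θ.1 l, neg_mem (ρ.space_mem θ l), -θ.1 j,
        neg_mem (ρ.mem_inf.2 hθ), ?_⟩
      have : ζ.1 i = 0 := hζ
      change _ = ζ.1 i + θ.1 i
      rw [this, zero_add, eq_comm, ← sub_eq_zero, ← hs]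
      abel
    · rintro ⟨s, hs, t, ht, hst⟩
      rw [mem_inf] at ht
      obtain ⟨θ, h1, h2, h3⟩ := ρ.exists_space h (ρ.space_mem η i) (neg_mem (ρ.hom_mono
        (x_le_y j) ht.1)) (neg_mem hs) (by rw [← hst]; abel)
      refine ⟨η - θ, ?_, θ, ?_, sub_add_cancel _ _⟩
      · change η.1 i - θ.1 i = 0
        rw [h1, sub_self]
      · rw [mem_inf, ih h.rotate, mem_coxeter_y, h2]
        exact ⟨neg_mem ht.1, neg_mem ht.2⟩

/-- The condition of `mem_coxeter_atomA` can be read off at the second index as well, because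
`A_n^{lj}` contains `y_l`. -/
theorem mem_coxeter_atomA' (h : Triple i j l) {n : ℕ} {η : ρ.space} :
    η ∈ ρ.coxeter (atomA n i j) ↔ η.1 j ∈ ρ (atomB n l j) := by
  rw [ρ.mem_coxeter_atomA h]
  exact mem_iff_mem_of_add_eq_zero (ρ.space_sum h η)
    (ρ.hom_mono (h.rotate.swap.y_le_atomB n) (ρ.space_mem η l))

/-- The atomic element `A_n^{ij}` of `Φ⁺ρ` is the preimage of `a_n^{il}` under `φ_i`. -/
theorem mem_coxeter_atomB (h : Triple i j l) {n : ℕ} {η : ρ.space} :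
    η ∈ ρ.coxeter (atomB n i j) ↔ η.1 i ∈ ρ (atomA n i l) := by
  induction n generalizing i j l η with
  | zero => exact iff_of_true (ρ.coxeter.mem_top _) (ρ.mem_top _)
  | succ n ih =>
    rw [h.atomB_succ, h.rotate.rotate.swap.atomA_succ, mem_sup, mem_sup]
    constructor
    · rintro ⟨ζ, hζ, θ, hθ, rfl⟩
      rw [mem_inf, ih h.rotate.rotate] at hθ
      have hs := ρ.space_sum h θ
      refine ⟨ζ.1 i, hζ, -θ.1 l,
        neg_mem (ρ.mem_inf.2 ⟨ρ.space_mem θ l, hθ.2⟩), ?_⟩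
      have hj : θ.1 j = 0 := hθ.1
      change _ = ζ.1 i + θ.1 i
      rw [hj, add_zero, add_eq_zero_iff_eq_neg] at hs
      rw [hs]
    · rintro ⟨s, hs, t, ht, hst⟩
      rw [mem_inf] at ht
      have hti : t ∈ ρ (y i) := by
        rw [eq_sub_of_add_eq' hst]
        exact sub_mem (ρ.space_mem η i) (ρ.mem_of_le (x_le_y i) hs)
      obtain ⟨θ, h1, h2, h3⟩ := ρ.exists_space h hti (zero_mem _) (neg_mem ht.1) (by abel)
      refine ⟨η - θ, ?_, θ, ?_, sub_add_cancel _ _⟩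
      · change η.1 i - θ.1 i ∈ ρ (x i)
        rwa [h1, ← hst, add_sub_cancel_right]
      · rw [mem_inf, ih h.rotate.rotate, mem_coxeter_x, h2, h3]
        exact ⟨rfl, neg_mem ht.2⟩

/-- The image of an element of `Φ⁺ρ` under an elementary map. -/
def image (c : Fin 3) (a : D222) : Submodule K V := (ρ.coxeter a).map (ρ.phi c)

theorem mem_image {c : Fin 3} {a : D222} {v : V} :
    v ∈ ρ.image c a ↔ ∃ η ∈ ρ.coxeter a, η.1 c = v := Iff.rfl

end Rep
/-! ### The elementary maps on the shapes of admissible elements -/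

/-- The shape of the elements `e_α` for `α` of even length; the order of the indices and the
exponents `s`, `t`, `p`, `q` depend on `α`. -/
def evenE (i j l : Fin 3) (s t p q : ℕ) : D222 :=
  y j ⊓ atomB s l j ⊓ atomA t j i ⊓ atomB p i l ⊓ atomA q i l

/-- The shape of the elements `e_α` for `α` of odd length. -/
def oddE (i j l : Fin 3) (s t p q : ℕ) : D222 :=
  y l ⊓ atomA s l i ⊓ atomB t i j ⊓ atomA p i j ⊓ atomB q j l

/-- The shape of the elements `f_α` for `α` of even length. -/
def evenF (i j l : Fin 3) (s t : ℕ) : D222 :=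
  y i ⊓ y j ⊓ atomA t i l ⊓ atomB s l j

/-- One of the two shapes of the elements `f_α` for `α` of odd length, the one that lies in the
sum of two generators `x`. -/
def oddF (i j l : Fin 3) (s t : ℕ) : D222 :=
  y l ⊓ (x i ⊔ x j) ⊓ atomB t j l ⊓ atomA s l i

/-- The other shape of the elements `f_α` for `α` of odd length, which lies in a generator `x`. -/
def oddX (i j l : Fin 3) (s t : ℕ) : D222 :=
  x l ⊓ atomB t i j ⊓ atomA s i j

namespace Rep

variable {K : Type u} {V : Type v} [Field K] [AddCommGroup V] [Module K V] (ρ : Rep K V)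
  {i j l : Fin 3}

/-- A vector `ξ` is the component `η_l` of some `η ∈ X_0^1` with the two other components in given
subspaces of `Y_i` and `Y_j` if and only if it lies in `Y_l` and in the sum of these subspaces. -/
theorem exists_space_iff (h : Triple i j l) {a b : D222} (ha : a ≤ y i) (hb : b ≤ y j) {ξ : V} :
    (∃ η : ρ.space, η.1 l = ξ ∧ η.1 i ∈ ρ a ∧ η.1 j ∈ ρ b) ↔ ξ ∈ ρ (y l) ∧ ξ ∈ ρ (a ⊔ b) := by
  constructor
  · rintro ⟨η, rfl, h1, h2⟩
    refine ⟨ρ.space_mem η l, ρ.mem_sup.2 ⟨-η.1 i, neg_mem h1, -η.1 j, neg_mem h2, ?_⟩⟩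
    rw [← neg_add, neg_eq_iff_add_eq_zero]
    exact ρ.space_sum h η
  · rintro ⟨h1, h2⟩
    obtain ⟨s, hs, t, ht, rfl⟩ := ρ.mem_sup.1 h2
    obtain ⟨η, e1, e2, e3⟩ := ρ.exists_space h (neg_mem (ρ.mem_of_le ha hs))
      (neg_mem (ρ.mem_of_le hb ht)) h1 (by abel)
    exact ⟨η, e3, e1 ▸ neg_mem hs, e2 ▸ neg_mem ht⟩

/-- If `η_l ∈ ρ(x_l)`, then membership in `a_n^{il}`, which contains `x_l`, may be tested at `η_i`
or at `η_j`. -/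
theorem mem_atomA_comm (h : Triple i j l) {n : ℕ} {η : ρ.space} (hl : η.1 l ∈ ρ (x l)) :
    η.1 i ∈ ρ (atomA n i l) ↔ η.1 j ∈ ρ (atomA n i l) :=
  mem_iff_mem_of_add_eq_zero (ρ.space_sum h η)
    (ρ.mem_of_le (h.rotate.rotate.swap.x_le_atomA_right n) hl)

theorem image_evenE_last (h : Triple i j l) (s t p q : ℕ) :
    ρ.image l (evenE i j l s t p q) = ρ (oddE i j l s (t + 1) p q) := by
  ext ξ
  have key := ρ.exists_space_iff (ξ := ξ) h le_rfl
    (inf_le_left.trans (x_le_y j) : x j ⊓ atomB t l i ≤ y j)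
  simp only [evenE, oddE, mem_image, mem_inf, h.atomB_succ, mem_coxeter_y,
    ρ.mem_coxeter_atomB h.rotate.swap, ρ.mem_coxeter_atomA h.swap,
    ρ.mem_coxeter_atomB h.rotate.rotate.swap, ρ.mem_coxeter_atomA' h.rotate.rotate.swap]
    at key ⊢
  constructor
  · rintro ⟨η, ⟨⟨⟨⟨hy, hs⟩, ht⟩, hp⟩, hq⟩, rfl⟩
    obtain ⟨h1, h2⟩ := key.1 ⟨η, rfl, ρ.space_mem η i, hy, ht⟩
    exact ⟨⟨⟨⟨h1, hs⟩, h2⟩, (ρ.mem_atomA_comm h.rotate.rotate.swap hy).1 hp⟩, hq⟩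
  · rintro ⟨⟨⟨⟨h1, hs⟩, h2⟩, hp⟩, hq⟩
    obtain ⟨η, rfl, -, hy, ht⟩ := key.2 ⟨h1, h2⟩
    exact ⟨η, ⟨⟨⟨⟨hy, hs⟩, ht⟩, (ρ.mem_atomA_comm h.rotate.rotate.swap hy).2 hp⟩, hq⟩, rfl⟩

theorem image_evenE_first (h : Triple i j l) (s t p q : ℕ) :
    ρ.image i (evenE i j l s t p q) = ρ (oddE j l i p q (s + 1) t) := by
  ext ξ
  have key := ρ.exists_space_iff (ξ := ξ) h.rotate (x_le_y j)
    (inf_le_left : y l ⊓ atomA s l i ≤ y l)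
  simp only [evenE, oddE, mem_image, mem_inf, h.rotate.atomA_succ, mem_coxeter_y,
    ρ.mem_coxeter_atomB h.rotate.swap, ρ.mem_coxeter_atomA' h.swap,
    ρ.mem_coxeter_atomB h.rotate.rotate.swap, ρ.mem_coxeter_atomA h.rotate.rotate.swap]
    at key ⊢
  constructor
  · rintro ⟨η, ⟨⟨⟨⟨hy, hs⟩, ht⟩, hp⟩, hq⟩, rfl⟩
    obtain ⟨h1, h2⟩ := key.1 ⟨η, rfl, hy, ρ.space_mem η l, hs⟩
    exact ⟨⟨⟨⟨h1, hp⟩, hq⟩, h2⟩, ht⟩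
  · rintro ⟨⟨⟨⟨h1, hp⟩, hq⟩, h2⟩, ht⟩
    obtain ⟨η, rfl, hy, -, hs⟩ := key.2 ⟨h1, h2⟩
    exact ⟨η, ⟨⟨⟨⟨hy, hs⟩, ht⟩, hp⟩, hq⟩, rfl⟩

theorem image_oddE_first (h : Triple i j l) (s t p q : ℕ) :
    ρ.image i (oddE i j l s t p q) = ρ (evenE l i j s t p (q + 1)) := by
  ext ξ
  have key := ρ.exists_space_iff (ξ := ξ) h.rotate.swap (x_le_y l)
    (inf_le_left : y j ⊓ atomA q j i ≤ y j)
  simp only [evenE, oddE, mem_image, mem_inf, h.rotate.swap.atomA_succ, mem_coxeter_y,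
    ρ.mem_coxeter_atomA' h.rotate.rotate, ρ.mem_coxeter_atomB h,
    ρ.mem_coxeter_atomA h, ρ.mem_coxeter_atomB h.rotate]
    at key ⊢
  constructor
  · rintro ⟨η, ⟨⟨⟨⟨hy, hs⟩, ht⟩, hp⟩, hq⟩, rfl⟩
    obtain ⟨h1, h2⟩ := key.1 ⟨η, rfl, hy, ρ.space_mem η j, hq⟩
    exact ⟨⟨⟨⟨h1, hs⟩, ht⟩, hp⟩, h2⟩
  · rintro ⟨⟨⟨⟨h1, hs⟩, ht⟩, hp⟩, h2⟩
    obtain ⟨η, rfl, hy, -, hq⟩ := key.2 ⟨h1, h2⟩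
    exact ⟨η, ⟨⟨⟨⟨hy, hs⟩, ht⟩, hp⟩, hq⟩, rfl⟩

theorem image_oddE_second (h : Triple i j l) (s t p q : ℕ) :
    ρ.image j (oddE i j l s t p q) = ρ (evenE i j l p q (s + 1) t) := by
  ext ξ
  have key := ρ.exists_space_iff (ξ := ξ) h.rotate.rotate.swap le_rfl
    (inf_le_left.trans (x_le_y l) : x l ⊓ atomB s j i ≤ y l)
  simp only [evenE, oddE, mem_image, mem_inf, h.rotate.rotate.swap.atomB_succ, mem_coxeter_y,
    ρ.mem_coxeter_atomA h.rotate.rotate, ρ.mem_coxeter_atomB h,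
    ρ.mem_coxeter_atomA' h, ρ.mem_coxeter_atomB h.rotate]
    at key ⊢
  constructor
  · rintro ⟨η, ⟨⟨⟨⟨hy, hs⟩, ht⟩, hp⟩, hq⟩, rfl⟩
    obtain ⟨h1, h2⟩ := key.1 ⟨η, rfl, ρ.space_mem η i, hy, hs⟩
    exact ⟨⟨⟨⟨h1, hp⟩, hq⟩, h2⟩, (ρ.mem_atomA_comm h hy).1 ht⟩
  · rintro ⟨⟨⟨⟨h1, hp⟩, hq⟩, h2⟩, ht⟩
    obtain ⟨η, rfl, -, hy, hs⟩ := key.2 ⟨h1, h2⟩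
    exact ⟨η, ⟨⟨⟨⟨hy, hs⟩, (ρ.mem_atomA_comm h hy).2 ht⟩, hp⟩, hq⟩, rfl⟩

/-- In `Φ⁺ρ` the element `x_i + x_j` consists of the `η` with `η_i ∈ ρ(y_l)`. -/
theorem mem_coxeter_x_sup (h : Triple i j l) {η : ρ.space} :
    η ∈ ρ.coxeter (x i ⊔ x j) ↔ η.1 i ∈ ρ (y l) := by
  rw [mem_sup]
  constructor
  · rintro ⟨ζ, hζ, θ, hθ, rfl⟩
    have hi : ζ.1 i = 0 := hζ
    have hj : θ.1 j = 0 := hθ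
    have hs := ρ.space_sum h θ
    rw [hj, add_zero, add_eq_zero_iff_eq_neg] at hs
    change ζ.1 i + θ.1 i ∈ _
    rw [hi, hs, zero_add]
    exact neg_mem (ρ.space_mem θ l)
  · intro hi
    obtain ⟨θ, h1, h2, -⟩ := ρ.exists_space h (ρ.space_mem η i) (zero_mem _) (neg_mem hi)
      (by abel)
    refine ⟨η - θ, ?_, θ, h2, sub_add_cancel _ _⟩
    change η.1 i - θ.1 i = 0
    rw [h1, sub_self]

theorem image_evenF_third (h : Triple i j l) (s t : ℕ) :
    ρ.image l (evenF i j l s t) = ρ (oddF i j l s t) := by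
  ext ξ
  have key := ρ.exists_space_iff (ξ := ξ) h (x_le_y i) (x_le_y j)
  simp only [evenF, oddF, mem_image, mem_inf, mem_coxeter_y,
    ρ.mem_coxeter_atomA' h.rotate.rotate.swap, ρ.mem_coxeter_atomB h.rotate.swap]
  constructor
  · rintro ⟨η, ⟨⟨⟨hi, hj⟩, ht⟩, hs⟩, rfl⟩
    exact ⟨⟨key.1 ⟨η, rfl, hi, hj⟩, ht⟩, hs⟩
  · rintro ⟨⟨h1, ht⟩, hs⟩
    obtain ⟨η, rfl, hi, hj⟩ := key.2 h1
    exact ⟨η, ⟨⟨⟨hi, hj⟩, ht⟩, hs⟩, rfl⟩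

theorem image_evenF_first (h : Triple i j l) (s t : ℕ) :
    ρ.image i (evenF i j l s t) = ρ (oddX j l i (s + 1) t) := by
  ext ξ
  have key := ρ.exists_space_iff (ξ := ξ) h.rotate (x_le_y j)
    (inf_le_left : y l ⊓ atomA s l i ≤ y l)
  simp only [evenF, oddX, mem_image, mem_inf, mem_coxeter_y, h.rotate.atomA_succ,
    ρ.mem_coxeter_atomA h.rotate.rotate.swap, ρ.mem_coxeter_atomB h.rotate.swap] at key ⊢
  constructor
  · rintro ⟨η, ⟨⟨⟨hi, hj⟩, ht⟩, hs⟩, rfl⟩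
    exact ⟨⟨hi, ht⟩, (key.1 ⟨η, rfl, hj, ρ.space_mem η l, hs⟩).2⟩
  · rintro ⟨⟨hi, ht⟩, h2⟩
    obtain ⟨η, rfl, hj, -, hs⟩ := key.2 ⟨ρ.mem_of_le (x_le_y i) hi, h2⟩
    exact ⟨η, ⟨⟨⟨hi, hj⟩, ht⟩, hs⟩, rfl⟩

theorem image_evenF_second (h : Triple i j l) (s t : ℕ) :
    ρ.image j (evenF i j l s t) = ρ (oddX l i j s (t + 1)) := by
  ext ξ
  have key := ρ.exists_space_iff (ξ := ξ) h.rotate.rotate le_rfl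
    (inf_le_left.trans (x_le_y i) : x i ⊓ atomB t j l ≤ y i)
  simp only [evenF, oddX, mem_image, mem_inf, mem_coxeter_y, h.rotate.rotate.atomB_succ,
    ρ.mem_coxeter_atomA h.rotate.rotate.swap, ρ.mem_coxeter_atomB h.rotate.swap] at key ⊢
  constructor
  · rintro ⟨η, ⟨⟨⟨hi, hj⟩, ht⟩, hs⟩, rfl⟩
    exact ⟨⟨hj, (key.1 ⟨η, rfl, ρ.space_mem η l, hi, ht⟩).2⟩,
      (ρ.mem_atomA_comm h.rotate.swap hi).1 hs⟩
  · rintro ⟨⟨hj, h2⟩, hs⟩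
    obtain ⟨η, rfl, -, hi, ht⟩ := key.2 ⟨ρ.mem_of_le (x_le_y j) hj, h2⟩
    exact ⟨η, ⟨⟨⟨hi, hj⟩, ht⟩, (ρ.mem_atomA_comm h.rotate.swap hi).2 hs⟩, rfl⟩

theorem image_oddF_first (h : Triple i j l) (s t : ℕ) :
    ρ.image i (oddF i j l s t) = ρ (evenF l i j s (t + 1)) := by
  ext ξ
  have key := ρ.exists_space_iff (ξ := ξ) h.rotate.swap (x_le_y l)
    (inf_le_left : y j ⊓ atomA t j i ≤ y j)
  simp only [evenF, oddF, mem_image, mem_inf, mem_coxeter_y, h.rotate.swap.atomA_succ,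
    ρ.mem_coxeter_x_sup h, ρ.mem_coxeter_atomA' h.rotate.rotate, ρ.mem_coxeter_atomB h.rotate]
    at key ⊢
  constructor
  · rintro ⟨η, ⟨⟨⟨hl, hi⟩, ht⟩, hs⟩, rfl⟩
    obtain ⟨h1, h2⟩ := key.1 ⟨η, rfl, hl, ρ.space_mem η j, ht⟩
    exact ⟨⟨⟨hi, h1⟩, h2⟩, hs⟩
  · rintro ⟨⟨⟨hi, h1⟩, h2⟩, hs⟩
    obtain ⟨η, rfl, hl, -, ht⟩ := key.2 ⟨h1, h2⟩
    exact ⟨η, ⟨⟨⟨hl, hi⟩, ht⟩, hs⟩, rfl⟩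

theorem image_oddF_second (h : Triple i j l) (s t : ℕ) :
    ρ.image j (oddF i j l s t) = ρ (evenF j l i (s + 1) t) := by
  ext ξ
  have key := ρ.exists_space_iff (ξ := ξ) h.rotate.rotate.swap le_rfl
    (inf_le_left.trans (x_le_y l) : x l ⊓ atomB s j i ≤ y l)
  rw [oddF, sup_comm]
  simp only [evenF, mem_image, mem_inf, mem_coxeter_y, h.rotate.rotate.swap.atomB_succ,
    ρ.mem_coxeter_x_sup h.swap, ρ.mem_coxeter_atomA h.rotate.rotate,
    ρ.mem_coxeter_atomB h.rotate] at key ⊢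
  constructor
  · rintro ⟨η, ⟨⟨⟨hl, hj⟩, ht⟩, hs⟩, rfl⟩
    obtain ⟨h1, h2⟩ := key.1 ⟨η, rfl, ρ.space_mem η i, hl, hs⟩
    exact ⟨⟨⟨h1, hj⟩, ht⟩, h2⟩
  · rintro ⟨⟨⟨h1, hj⟩, ht⟩, h2⟩
    obtain ⟨η, rfl, -, hl, hs⟩ := key.2 ⟨h1, h2⟩
    exact ⟨η, ⟨⟨⟨hl, hj⟩, ht⟩, hs⟩, rfl⟩

theorem image_oddX_first (h : Triple i j l) (s t : ℕ) :
    ρ.image i (oddX i j l s t) = ρ (evenF i j l s t) := by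
  ext ξ
  simp only [evenF, oddX, mem_image, mem_inf, mem_coxeter_x,
    ρ.mem_coxeter_atomA h, ρ.mem_coxeter_atomB h]
  constructor
  · rintro ⟨η, ⟨⟨hl, ht⟩, hs⟩, rfl⟩
    have hj : η.1 i ∈ ρ (y j) := (mem_iff_mem_of_add_eq_zero (ρ.space_sum h η) (by simp [hl])).2
      (ρ.space_mem η j)
    exact ⟨⟨⟨ρ.space_mem η i, hj⟩, ht⟩, hs⟩
  · rintro ⟨⟨⟨hi, hj⟩, ht⟩, hs⟩
    obtain ⟨η, rfl, -, hl⟩ := ρ.exists_space h hi (neg_mem hj) (zero_mem _) (by abel)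
    exact ⟨η, ⟨⟨hl, ht⟩, hs⟩, rfl⟩

theorem image_oddX_second (h : Triple i j l) (s t : ℕ) :
    ρ.image j (oddX i j l s t) = ρ (evenF i j l s t) := by
  rw [← ρ.image_oddX_first h]
  -- On `x_l` the maps `φ_i` and `φ_j` differ by a sign.
  have key : ∀ η ∈ ρ.coxeter (oddX i j l s t), η.1 i = -η.1 j := fun η hη => by
    have hl : η.1 l = 0 := ρ.coxeter.mem_of_le (inf_le_left.trans inf_le_left) hη
    rw [← add_eq_zero_iff_eq_neg, ← ρ.space_sum h η, hl, add_zero]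
  ext ξ
  constructor
  · rintro ⟨η, hη, rfl⟩
    exact ⟨-η, neg_mem hη, (key _ (neg_mem hη)).trans (neg_neg _)⟩
  · rintro ⟨η, hη, rfl⟩
    exact ⟨-η, neg_mem hη, (key _ hη).symm⟩

end Rep
/-! ### The elementary maps and the normal forms of sequences -/

/-- The element `f_α` of `α = i(ji)^n`, written by means of the triple `i, j, l`. -/
def altF (i j l : Fin 3) (n : ℕ) : D222 :=
  if n % 2 = 0 then oddX j l i (n / 2) (n / 2) else oddF j l i (n / 2) (n / 2)

/-- The element `e_α` of `α = i(ji)^n`, written by means of the triple `i, j, l`. -/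
def altE (i j l : Fin 3) (n : ℕ) : D222 :=
  oddE j l i (n / 2) ((n + 1) / 2) ((n + 1) / 2) (n / 2)

theorem altF_le (i j l : Fin 3) (n : ℕ) : altF i j l n ≤ y i := by
  unfold altF
  split_ifs
  · exact inf_le_left.trans (inf_le_left.trans (x_le_y i))
  · exact inf_le_left.trans (inf_le_left.trans inf_le_left)

theorem altE_le (i j l : Fin 3) (n : ℕ) : altE i j l n ≤ y i :=
  inf_le_left.trans (inf_le_left.trans (inf_le_left.trans inf_le_left))

theorem triple_add (i : Fin 3) : Triple i (i + 1) (i + 2) := by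
  constructor <;> revert i <;> decide

theorem Triple.eq_add {i j l : Fin 3} (h : Triple i j l) :
    (j = i + 1 ∧ l = i + 2) ∨ (j = i + 2 ∧ l = i + 1) := by
  obtain ⟨h1, h2, h3⟩ := h
  revert i j l
  decide

namespace NormalForm

variable {i j l : Fin 3} {m n : ℕ}

theorem e_alt (i : Fin 3) (n : ℕ) : (alt i n).e = altE i (i + 1) (i + 2) n := by
  rcases Nat.mod_two_eq_zero_or_one n with hn | hn
  · have h : (n + 1) / 2 = n / 2 := by omega
    simp only [e, altE, oddE, hn, h, if_true]
    ac_rfl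
  · have h : (n + 1) / 2 = n / 2 + 1 := by omega
    simp only [e, altE, oddE, hn, h, one_ne_zero, if_false]
    ac_rfl

/-! The table of the elements `f_α`, `e_α` in terms of their shapes, by the parities of `m` and
`n`. -/

theorem f_chain_even_even (h : Triple i j l) (hm : m % 2 = 0) (hn : n % 2 = 0) :
    (chain i j 0 m n).f = evenF i j l (n / 2 - 1) (n / 2 + 3 * (m / 2)) ∧
    (chain i j 1 m n).f = oddF i j l (n / 2 - 1) (n / 2 + 3 * (m / 2)) ∧
    (chain i j 2 m n).f = evenF l i j (n / 2 - 1) (n / 2 + 3 * (m / 2) + 1) := by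
  simp [f, hm, hn, h.third_eq, evenF, oddF]

theorem f_chain_odd_even (h : Triple i j l) (hm : m % 2 = 1) (hn : n % 2 = 0) :
    (chain i j 0 m n).f = oddF l i j (n / 2 - 1) (n / 2 + 3 * (m / 2) + 1) ∧
    (chain i j 1 m n).f = evenF j l i (n / 2 - 1) (n / 2 + 3 * (m / 2) + 2) ∧
    (chain i j 2 m n).f = oddF j l i (n / 2 - 1) (n / 2 + 3 * (m / 2) + 2) := by
  simp [f, hm, hn, h.third_eq, evenF, oddF]

theorem f_chain_even_odd (h : Triple i j l) (hm : m % 2 = 0) (hn : n % 2 = 1) :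
    (chain i j 0 m n).f = evenF j l i (n / 2) (n / 2 + 3 * (m / 2)) ∧
    (chain i j 1 m n).f = oddX i j l (n / 2) (n / 2 + 3 * (m / 2) + 1) ∧
    (chain i j 2 m n).f = evenF i j l (n / 2) (n / 2 + 3 * (m / 2) + 1) := by
  simp [f, hm, hn, h.third_eq, evenF, oddX]

theorem f_chain_odd_odd (h : Triple i j l) (hm : m % 2 = 1) (hn : n % 2 = 1) :
    (chain i j 0 m n).f = oddX l i j (n / 2) (n / 2 + 3 * (m / 2) + 2) ∧
    (chain i j 1 m n).f = evenF l i j (n / 2) (n / 2 + 3 * (m / 2) + 2) ∧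
    (chain i j 2 m n).f = oddX j l i (n / 2) (n / 2 + 3 * (m / 2) + 3) := by
  simp [f, hm, hn, h.third_eq, evenF, oddX]

theorem e_chain_even (h : Triple i j l) (hm : m % 2 = 0) (hn : 1 ≤ n) :
    (chain i j 0 m n).e = evenE i j l ((n - 1) / 2) (n / 2 + 3 * (m / 2)) (n / 2)
      ((n + 1) / 2 + 3 * (m / 2)) ∧
    (chain i j 1 m n).e = oddE i j l ((n - 1) / 2) (n / 2 + 3 * (m / 2) + 1) (n / 2)
      ((n + 1) / 2 + 3 * (m / 2)) ∧
    (chain i j 2 m n).e = evenE l i j ((n - 1) / 2) (n / 2 + 3 * (m / 2) + 1) (n / 2)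
      ((n + 1) / 2 + 3 * (m / 2) + 1) := by
  rcases Nat.mod_two_eq_zero_or_one n with h0 | h0
  · have h1 : (n - 1) / 2 = n / 2 - 1 := by omega
    have h2 : (n + 1) / 2 = n / 2 := by omega
    simp [e, hm, h0, h1, h2, h.third_eq, evenE, oddE]
  · have h1 : (n - 1) / 2 = n / 2 := by omega
    have h2 : ∀ q, (n + 1) / 2 + q = n / 2 + q + 1 := by omega
    simp [e, hm, h0, h1, h2, h.third_eq, evenE, oddE]

theorem e_chain_odd (h : Triple i j l) (hm : m % 2 = 1) (hn : 1 ≤ n) :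
    (chain i j 0 m n).e = oddE l i j ((n - 1) / 2) (n / 2 + 3 * (m / 2) + 2) (n / 2)
      ((n + 1) / 2 + 3 * (m / 2) + 1) ∧
    (chain i j 1 m n).e = evenE j l i ((n - 1) / 2) (n / 2 + 3 * (m / 2) + 2) (n / 2)
      ((n + 1) / 2 + 3 * (m / 2) + 2) ∧
    (chain i j 2 m n).e = oddE j l i ((n - 1) / 2) (n / 2 + 3 * (m / 2) + 3) (n / 2)
      ((n + 1) / 2 + 3 * (m / 2) + 2) := by
  rcases Nat.mod_two_eq_zero_or_one n with h0 | h0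
  · have h1 : (n - 1) / 2 = n / 2 - 1 := by omega
    have h2 : (n + 1) / 2 = n / 2 := by omega
    simp [e, hm, h0, h1, h2, h.third_eq, evenE, oddE]
  · have h1 : (n - 1) / 2 = n / 2 := by omega
    have h2 : ∀ q, (n + 1) / 2 + q = n / 2 + q + 1 := by omega
    simp [e, hm, h0, h1, h2, h.third_eq, evenE, oddE]

end NormalForm

open NormalForm

namespace Rep

variable {K : Type u} {V : Type v} [Field K] [AddCommGroup V] [Module K V] (ρ : Rep K V)
  {i j l : Fin 3}

theorem f_chain_zero (h : Triple i j l) (n : ℕ) :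
    ρ (chain i j 0 0 (n + 1)).f = ρ.image j (altF i j l n) := by
  rcases Nat.mod_two_eq_zero_or_one n with hn | hn
  · rw [altF, if_pos hn, ρ.image_oddX_first h.rotate,
      (f_chain_even_odd h rfl (by omega : (n + 1) % 2 = 1)).1]
    exact congrArg _ (by congr 1 <;> omega)
  · rw [altF, if_neg (by omega), ρ.image_oddF_first h.rotate,
      (f_chain_even_even h rfl (by omega : (n + 1) % 2 = 0)).1]
    exact congrArg _ (by congr 1 <;> omega)

theorem altF_succ (h : Triple i j l) (n : ℕ) :
    ρ (altF i j l (n + 1)) = ρ.image i (chain i j 0 0 (n + 1)).f := by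
  rcases Nat.mod_two_eq_zero_or_one n with hn | hn
  · rw [altF, if_neg (by omega), (f_chain_even_odd h rfl (by omega : (n + 1) % 2 = 1)).1,
      ρ.image_evenF_third h.rotate]
    exact congrArg _ (by congr 1)
  · rw [altF, if_pos (by omega), (f_chain_even_even h rfl (by omega : (n + 1) % 2 = 0)).1,
      ρ.image_evenF_first h]
    exact congrArg _ (by congr 1; omega)

theorem e_chain_zero (h : Triple i j l) (n : ℕ) :
    ρ (chain i j 0 0 (n + 1)).e = ρ.image j (altE i j l n) := by
  rw [altE, ρ.image_oddE_first h.rotate, (e_chain_even h rfl (by omega : 1 ≤ n + 1)).1]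
  exact congrArg _ (by congr 1; omega)

theorem altE_succ (h : Triple i j l) (n : ℕ) :
    ρ (altE i j l (n + 1)) = ρ.image i (chain i j 0 0 (n + 1)).e := by
  rw [(e_chain_even h rfl (by omega : 1 ≤ n + 1)).1, ρ.image_evenE_first h]
  exact congrArg _ (by rw [altE]; congr 1; omega)

/-- On the subspaces of `Φ⁺Φ⁺ρ` that lie in `Y_i` the composites `φ_i φ_j` and `φ_i φ_l` differ
by a sign, since `φ_j + φ_l = -φ_i` takes `Y_i` to `X_i` and `φ_i` kills `X_i`. -/
theorem image_image_le (h : Triple i j l) {a b c : D222} (ha : a ≤ y i)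
    (hb : ρ.coxeter b ≤ ρ.coxeter.image j a) (hc : ρ.coxeter.image l a ≤ ρ.coxeter c) :
    ρ.image i b ≤ ρ.image i c := by
  rintro _ ⟨η, hη, rfl⟩
  obtain ⟨ζ, hζ, rfl⟩ := hb hη
  refine ⟨-ζ.1 l, neg_mem (hc ⟨ζ, hζ, rfl⟩), ?_⟩
  have h1 : (ζ.1 i).1 i = 0 := ρ.coxeter.coxeter.mem_of_le ha hζ
  have h2 := congrArg (fun η : ρ.space => η.1 i) (ρ.coxeter.space_sum h ζ)
  change (ζ.1 i).1 i + (ζ.1 j).1 i + (ζ.1 l).1 i = 0 at h2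
  rw [h1, zero_add] at h2
  exact (eq_neg_of_add_eq_zero_left h2).symm

theorem image_congr {c : Fin 3} {a b : D222} (h : ρ.coxeter a = ρ.coxeter b) :
    ρ.image c a = ρ.image c b := by
  rw [image, image, h]

/-- The element `f_α` of `α = i(ji)^n` is the same as that of `i(li)^n` in every representation. -/
theorem altF_comm_le (n : ℕ) : ∀ {V : Type v} [AddCommGroup V] [Module K V] (ρ : Rep K V)
    {i j l : Fin 3}, Triple i j l → ρ (altF i j l n) ≤ ρ (altF i l j n) := by
  induction n with
  | zero => intro V _ _ ρ i j l _; simp [altF, oddX, atomA, atomB]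
  | succ n ih =>
    intro V _ _ ρ i j l h
    have h' := h.rotate.rotate.swap
    rw [ρ.altF_succ h, ρ.altF_succ h']
    refine ρ.image_image_le h (altF_le i j l n) (ρ.coxeter.f_chain_zero h n).le ?_
    rw [ρ.coxeter.f_chain_zero h' n]
    exact (ρ.coxeter.image_congr (le_antisymm (ih _ h) (ih _ h'))).le

/-- The element `e_α` of `α = i(ji)^n` is the same as that of `i(li)^n` in every representation. -/
theorem altE_comm_le (n : ℕ) : ∀ {V : Type v} [AddCommGroup V] [Module K V] (ρ : Rep K V)
    {i j l : Fin 3}, Triple i j l → ρ (altE i j l n) ≤ ρ (altE i l j n) := by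
  induction n with
  | zero => intro V _ _ ρ i j l _; simp [altE, oddE, atomA, atomB]
  | succ n ih =>
    intro V _ _ ρ i j l h
    have h' := h.rotate.rotate.swap
    rw [ρ.altE_succ h, ρ.altE_succ h']
    refine ρ.image_image_le h (altE_le i j l n) (ρ.coxeter.e_chain_zero h n).le ?_
    rw [ρ.coxeter.e_chain_zero h' n]
    exact (ρ.coxeter.image_congr (le_antisymm (ih _ h) (ih _ h'))).le

theorem f_alt_eq (h : Triple i j l) (n : ℕ) : ρ (alt i n).f = ρ (altF i j l n) := by
  rcases h.eq_add with ⟨rfl, rfl⟩ | ⟨rfl, rfl⟩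
  · rfl
  · exact le_antisymm (altF_comm_le n ρ (triple_add i)) (altF_comm_le n ρ h)

theorem e_alt_eq (h : Triple i j l) (n : ℕ) : ρ (alt i n).e = ρ (altE i j l n) := by
  rw [e_alt]
  rcases h.eq_add with ⟨rfl, rfl⟩ | ⟨rfl, rfl⟩
  · rfl
  · exact le_antisymm (altE_comm_le n ρ (triple_add i)) (altE_comm_le n ρ h)

/-- `φ_c Φ⁺ρ(e_α) = ρ(e_{cα})` when `c` differs from the first index of `α`. -/
theorem step_e {c : Fin 3} {F : NormalForm} (hF : F.Valid) (hc : c ≠ F.lead) :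
    ρ (step c F).e = ρ.image c F.e := by
  cases F with
  | alt i n =>
    have h : Triple i c (third i c) := .of_ne (Ne.symm hc)
    rw [ρ.image_congr (ρ.coxeter.e_alt_eq h n), ← ρ.e_chain_zero h]
    rfl
  | chain i j r m n =>
    obtain ⟨hij, hn⟩ := hF
    have h := Triple.of_ne hij
    generalize third i j = l at h
    have hl : third i j = l := h.third_eq
    have hn' : 1 ≤ n + 1 := by omega
    rcases fin3_cases r with rfl | rfl | rfl
    · have hcj : c ≠ j := hc
      rcases h.eq_or c with rfl | rfl | rfl
      · rcases m with _ | m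
        · have : step c (chain c j 0 0 n) = alt c n := by simp [step]
          obtain ⟨n, rfl⟩ : ∃ k, n = k + 1 := ⟨n - 1, by omega⟩
          rw [this, ρ.e_alt_eq h, ρ.altE_succ h]
        · have : step c (chain c j 0 (m + 1) n) = chain c j 2 m (n + 1) := by simp [step]
          rw [this]
          rcases Nat.mod_two_eq_zero_or_one m with hm | hm
          · rw [(e_chain_even h hm hn').2.2,
              (e_chain_odd h (by omega : (m + 1) % 2 = 1) hn).1,
              ρ.image_oddE_second h.rotate.rotate]
            exact congrArg _ (by congr 1 <;> omega)
          · rw [(e_chain_odd h hm hn').2.2,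
              (e_chain_even h (by omega : (m + 1) % 2 = 0) hn).1, ρ.image_evenE_first h]
            exact congrArg _ (by congr 1 <;> omega)
      · exact absurd rfl hcj
      · have : step c (chain i j 0 m n) = chain i j 1 m n := by simp [step, h.il.symm]
        rw [this]
        rcases Nat.mod_two_eq_zero_or_one m with hm | hm
        · rw [(e_chain_even h hm hn).2.1, (e_chain_even h hm hn).1, ρ.image_evenE_last h]
        · rw [(e_chain_odd h hm hn).2.1, (e_chain_odd h hm hn).1,
            ρ.image_oddE_first h.rotate.rotate]
    · have hcl : c ≠ l := hl ▸ hc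
      rcases h.eq_or c with rfl | rfl | rfl
      · have : step c (chain c j 1 m n) = chain c j 2 m n := by simp [step]
        rw [this]
        rcases Nat.mod_two_eq_zero_or_one m with hm | hm
        · rw [(e_chain_even h hm hn).2.2, (e_chain_even h hm hn).2.1, ρ.image_oddE_first h]
        · rw [(e_chain_odd h hm hn).2.2, (e_chain_odd h hm hn).2.1, ρ.image_evenE_last h.rotate]
      · have : step c (chain i c 1 m n) = chain i c 0 m (n + 1) := by simp [step, h.ij.symm]
        rw [this]
        rcases Nat.mod_two_eq_zero_or_one m with hm | hm
        · rw [(e_chain_even h hm hn').1, (e_chain_even h hm hn).2.1, ρ.image_oddE_second h]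
          exact congrArg _ (by congr 1 <;> omega)
        · rw [(e_chain_odd h hm hn').1, (e_chain_odd h hm hn).2.1, ρ.image_evenE_first h.rotate]
          exact congrArg _ (by congr 1 <;> omega)
      · exact absurd rfl hcl
    · have hci : c ≠ i := hc
      rcases h.eq_or c with rfl | rfl | rfl
      · exact absurd rfl hci
      · have : step c (chain i c 2 m n) = chain i c 0 (m + 1) n := by simp [step]
        rw [this]
        rcases Nat.mod_two_eq_zero_or_one m with hm | hm
        · rw [(e_chain_odd h (by omega : (m + 1) % 2 = 1) hn).1, (e_chain_even h hm hn).2.2,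
            ρ.image_evenE_last h.rotate.rotate]
          exact congrArg _ (by congr 1 <;> omega)
        · rw [(e_chain_even h (by omega : (m + 1) % 2 = 0) hn).1, (e_chain_odd h hm hn).2.2,
            ρ.image_oddE_first h.rotate]
          exact congrArg _ (by congr 1 <;> omega)
      · have : step c (chain i j 2 m n) = chain i j 1 m (n + 1) := by simp [step, h.jl.symm]
        rw [this]
        rcases Nat.mod_two_eq_zero_or_one m with hm | hm
        · rw [(e_chain_even h hm hn').2.1, (e_chain_even h hm hn).2.2,
            ρ.image_evenE_first h.rotate.rotate]
          exact congrArg _ (by congr 1 <;> omega)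
        · rw [(e_chain_odd h hm hn').2.1, (e_chain_odd h hm hn).2.2,
            ρ.image_oddE_second h.rotate]
          exact congrArg _ (by congr 1 <;> omega)

/-- `φ_c Φ⁺ρ(f_α) = ρ(f_{cα})` when `c` differs from the first index of `α`. -/
theorem step_f {c : Fin 3} {F : NormalForm} (hF : F.Valid) (hc : c ≠ F.lead) :
    ρ (step c F).f = ρ.image c F.f := by
  cases F with
  | alt i n =>
    have h : Triple i c (third i c) := .of_ne (Ne.symm hc)
    rw [ρ.image_congr (ρ.coxeter.f_alt_eq h n), ← ρ.f_chain_zero h]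
    rfl
  | chain i j r m n =>
    obtain ⟨hij, hn⟩ := hF
    have h := Triple.of_ne hij
    generalize third i j = l at h
    have hl : third i j = l := h.third_eq
    rcases fin3_cases r with rfl | rfl | rfl
    · have hcj : c ≠ j := hc
      rcases h.eq_or c with rfl | rfl | rfl
      · rcases m with _ | m
        · have : step c (chain c j 0 0 n) = alt c n := by simp [step]
          obtain ⟨n, rfl⟩ : ∃ k, n = k + 1 := ⟨n - 1, by omega⟩
          rw [this, ρ.f_alt_eq h, ρ.altF_succ h]
        · have : step c (chain c j 0 (m + 1) n) = chain c j 2 m (n + 1) := by simp [step]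
          rw [this]
          rcases Nat.mod_two_eq_zero_or_one m with hm | hm <;>
            rcases Nat.mod_two_eq_zero_or_one n with hp | hp
          · rw [(f_chain_even_odd h hm (by omega : (n + 1) % 2 = 1)).2.2,
              (f_chain_odd_even h (by omega : (m + 1) % 2 = 1) hp).1,
              ρ.image_oddF_second h.rotate.rotate]
            exact congrArg _ (by congr 1 <;> omega)
          · rw [(f_chain_even_even h hm (by omega : (n + 1) % 2 = 0)).2.2,
              (f_chain_odd_odd h (by omega : (m + 1) % 2 = 1) hp).1,
              ρ.image_oddX_second h.rotate.rotate]
            exact congrArg _ (by congr 1 <;> omega)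
          · rw [(f_chain_odd_odd h hm (by omega : (n + 1) % 2 = 1)).2.2,
              (f_chain_even_even h (by omega : (m + 1) % 2 = 0) hp).1, ρ.image_evenF_first h]
            exact congrArg _ (by congr 1 <;> omega)
          · rw [(f_chain_odd_even h hm (by omega : (n + 1) % 2 = 0)).2.2,
              (f_chain_even_odd h (by omega : (m + 1) % 2 = 0) hp).1, ρ.image_evenF_third h.rotate]
            exact congrArg _ (by congr 1 <;> omega)
      · exact absurd rfl hcj
      · have : step c (chain i j 0 m n) = chain i j 1 m n := by simp [step, h.il.symm]
        rw [this]
        rcases Nat.mod_two_eq_zero_or_one m with hm | hm <;>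
          rcases Nat.mod_two_eq_zero_or_one n with hp | hp
        · rw [(f_chain_even_even h hm hp).2.1,
            (f_chain_even_even h hm hp).1, ρ.image_evenF_third h]
        · rw [(f_chain_even_odd h hm hp).2.1,
            (f_chain_even_odd h hm hp).1, ρ.image_evenF_second h.rotate]
        · rw [(f_chain_odd_even h hm hp).2.1,
            (f_chain_odd_even h hm hp).1, ρ.image_oddF_first h.rotate.rotate]
        · rw [(f_chain_odd_odd h hm hp).2.1,
            (f_chain_odd_odd h hm hp).1, ρ.image_oddX_first h.rotate.rotate]
    · have hcl : c ≠ l := hl ▸ hc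
      rcases h.eq_or c with rfl | rfl | rfl
      · have : step c (chain c j 1 m n) = chain c j 2 m n := by simp [step]
        rw [this]
        rcases Nat.mod_two_eq_zero_or_one m with hm | hm <;>
          rcases Nat.mod_two_eq_zero_or_one n with hp | hp
        · rw [(f_chain_even_even h hm hp).2.2,
            (f_chain_even_even h hm hp).2.1, ρ.image_oddF_first h]
        · rw [(f_chain_even_odd h hm hp).2.2,
            (f_chain_even_odd h hm hp).2.1, ρ.image_oddX_first h]
        · rw [(f_chain_odd_even h hm hp).2.2,
            (f_chain_odd_even h hm hp).2.1, ρ.image_evenF_third h.rotate]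
        · rw [(f_chain_odd_odd h hm hp).2.2,
            (f_chain_odd_odd h hm hp).2.1, ρ.image_evenF_second h.rotate.rotate]
      · have : step c (chain i c 1 m n) = chain i c 0 m (n + 1) := by simp [step, h.ij.symm]
        rw [this]
        rcases Nat.mod_two_eq_zero_or_one m with hm | hm <;>
          rcases Nat.mod_two_eq_zero_or_one n with hp | hp
        · rw [(f_chain_even_odd h hm (by omega : (n + 1) % 2 = 1)).1,
            (f_chain_even_even h hm hp).2.1, ρ.image_oddF_second h]
          exact congrArg _ (by congr 1 <;> omega)
        · rw [(f_chain_even_even h hm (by omega : (n + 1) % 2 = 0)).1,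
            (f_chain_even_odd h hm hp).2.1, ρ.image_oddX_second h]
          exact congrArg _ (by congr 1 <;> omega)
        · rw [(f_chain_odd_odd h hm (by omega : (n + 1) % 2 = 1)).1,
            (f_chain_odd_even h hm hp).2.1, ρ.image_evenF_first h.rotate]
          exact congrArg _ (by congr 1 <;> omega)
        · rw [(f_chain_odd_even h hm (by omega : (n + 1) % 2 = 0)).1,
            (f_chain_odd_odd h hm hp).2.1, ρ.image_evenF_third h.rotate.rotate]
          exact congrArg _ (by congr 1 <;> omega)
      · exact absurd rfl hcl
    · have hci : c ≠ i := hc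
      rcases h.eq_or c with rfl | rfl | rfl
      · exact absurd rfl hci
      · have : step c (chain i c 2 m n) = chain i c 0 (m + 1) n := by simp [step]
        rw [this]
        rcases Nat.mod_two_eq_zero_or_one m with hm | hm <;>
          rcases Nat.mod_two_eq_zero_or_one n with hp | hp
        · rw [(f_chain_odd_even h (by omega : (m + 1) % 2 = 1) hp).1,
            (f_chain_even_even h hm hp).2.2, ρ.image_evenF_third h.rotate.rotate]
          exact congrArg _ (by congr 1; omega)
        · rw [(f_chain_odd_odd h (by omega : (m + 1) % 2 = 1) hp).1,
            (f_chain_even_odd h hm hp).2.2, ρ.image_evenF_second h]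
          exact congrArg _ (by congr 1; omega)
        · rw [(f_chain_even_even h (by omega : (m + 1) % 2 = 0) hp).1,
            (f_chain_odd_even h hm hp).2.2, ρ.image_oddF_first h.rotate]
          exact congrArg _ (by congr 1; omega)
        · rw [(f_chain_even_odd h (by omega : (m + 1) % 2 = 0) hp).1,
            (f_chain_odd_odd h hm hp).2.2, ρ.image_oddX_first h.rotate]
          exact congrArg _ (by congr 1; omega)
      · have : step c (chain i j 2 m n) = chain i j 1 m (n + 1) := by simp [step, h.jl.symm]
        rw [this]
        rcases Nat.mod_two_eq_zero_or_one m with hm | hm <;>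
          rcases Nat.mod_two_eq_zero_or_one n with hp | hp
        · rw [(f_chain_even_odd h hm (by omega : (n + 1) % 2 = 1)).2.1,
            (f_chain_even_even h hm hp).2.2, ρ.image_evenF_first h.rotate.rotate]
          exact congrArg _ (by congr 1 <;> omega)
        · rw [(f_chain_even_even h hm (by omega : (n + 1) % 2 = 0)).2.1,
            (f_chain_even_odd h hm hp).2.2, ρ.image_evenF_third h]
          exact congrArg _ (by congr 1 <;> omega)
        · rw [(f_chain_odd_odd h hm (by omega : (n + 1) % 2 = 1)).2.1,
            (f_chain_odd_even h hm hp).2.2, ρ.image_oddF_second h.rotate]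
          exact congrArg _ (by congr 1 <;> omega)
        · rw [(f_chain_odd_even h hm (by omega : (n + 1) % 2 = 0)).2.1,
            (f_chain_odd_odd h hm hp).2.2, ρ.image_oddX_second h.rotate]
          exact congrArg _ (by congr 1 <;> omega)

end Rep
/-! ### Cumulative polynomials -/

theorem mem_admSeqs {t : Fin 3} {n : ℕ} {α : List.Vector (Fin 3) n} :
    α ∈ admSeqs t n ↔ Admissible α.toList ∧ α.toList.getLast? = some t := by
  simp [admSeqs]

theorem le_cum {g : List (Fin 3) → D222} {t : Fin 3} {n : ℕ} {α : List (Fin 3)}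
    (hα : Admissible α) (ht : α.getLast? = some t) (hn : α.length = n) :
    g α ≤ (admSeqs t n).sup fun α => g α.toList :=
  Finset.le_sup (f := fun α : List.Vector (Fin 3) n => g α.toList) (b := ⟨α, hn⟩)
    (mem_admSeqs.2 ⟨hα, ht⟩)

theorem exists_triple (i : Fin 3) : ∃ j l, Triple i j l := ⟨_, _, triple_add i⟩

theorem exists_cons_of_mem {t : Fin 3} {n : ℕ} {α : List.Vector (Fin 3) (n + 1)}
    (hα : α ∈ admSeqs t (n + 1)) : ∃ c β, α.toList = c :: β ∧ β.length = n ∧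
      Admissible (c :: β) ∧ (c :: β).getLast? = some t := by
  obtain ⟨h1, h2⟩ := mem_admSeqs.1 hα
  obtain ⟨α, hn⟩ := α
  change Admissible α at h1
  change α.getLast? = some t at h2
  cases α with
  | nil => simp at hn
  | cons c β => exact ⟨c, β, rfl, by simpa using hn, h1, h2⟩

theorem admissible_cons {c d : Fin 3} {β : List (Fin 3)} (hc : c ≠ d)
    (h : Admissible (d :: β)) : Admissible (c :: d :: β) :=
  List.isChain_cons_cons.2 ⟨hc, h⟩

theorem admSeqs_nonempty (t : Fin 3) (n : ℕ) : (admSeqs t (n + 1)).Nonempty := by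
  induction n with
  | zero => exact ⟨⟨[t], rfl⟩, mem_admSeqs.2 ⟨List.isChain_singleton t, rfl⟩⟩
  | succ n ih =>
    obtain ⟨α, hα⟩ := ih
    obtain ⟨d, β, -, hn, h1, h2⟩ := exists_cons_of_mem hα
    exact ⟨⟨(d + 1) :: d :: β, by simp [hn]⟩,
      mem_admSeqs.2 ⟨admissible_cons (ne_add_one d).symm h1, by simpa using h2⟩⟩

theorem sup_admSeqs_one (g : List (Fin 3) → D222) (t : Fin 3) :
    ((admSeqs t 1).sup fun α => g α.toList) = g [t] := by
  refine le_antisymm (Finset.sup_le fun α hα => ?_) (le_cum (List.isChain_singleton t) rfl rfl)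
  obtain ⟨c, β, e, hn, -, h2⟩ := exists_cons_of_mem hα
  obtain rfl := List.length_eq_zero_iff.1 hn
  obtain rfl : c = t := by simpa using h2
  exact (congrArg g e).le

theorem cumX_one (t : Fin 3) : cumX t 1 = x t := by
  rw [cumX, sup_admSeqs_one admF]
  simp [admF, ofSeq, f, atomA, atomB]

theorem cumY_one (t : Fin 3) : cumY t 1 = y t := by
  rw [cumY, sup_admSeqs_one admE]
  simp [admE, ofSeq, e, atomA, atomB]

namespace Rep

variable {K : Type u} {V : Type v} [Field K] [AddCommGroup V] [Module K V] (ρ : Rep K V)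
  {i j l : Fin 3}

theorem image_le_sumPhi (c : Fin 3) (a : D222) : ρ.image c a ≤ ρ.sumPhi a :=
  le_iSup (fun k => ρ.image k a) c

theorem sumPhi_sup (a b : D222) : ρ.sumPhi (a ⊔ b) = ρ.sumPhi a ⊔ ρ.sumPhi b := by
  simp only [sumPhi, map_sup, Submodule.map_sup, iSup_sup_eq]

/-- Since `φ_1 + φ_2 + φ_3 = 0`, each elementary map is controlled by the two others. -/
theorem image_le_sup (h : Triple i j l) (a : D222) : ρ.image i a ≤ ρ.image j a ⊔ ρ.image l a := by
  rintro _ ⟨η, hη, rfl⟩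
  have hs := ρ.space_sum h η
  rw [add_assoc, add_eq_zero_iff_eq_neg, neg_add] at hs
  change η.1 i ∈ _
  rw [hs]
  exact Submodule.add_mem_sup (neg_mem ⟨η, hη, rfl⟩) (neg_mem ⟨η, hη, rfl⟩)

theorem hom_finset_sup {ι : Type*} {s : Finset ι} (hs : s.Nonempty) (g : ι → D222) :
    ρ (s.sup g) = s.sup fun a => ρ (g a) := by
  rw [← Finset.sup'_eq_sup hs, ← Finset.sup'_eq_sup hs, map_finset_sup']
  rfl

/-- Summation over the admissible sequences of length `n` ending in `t` turns the action of the
elementary maps on the summands into the passage from `n` to `n + 1`. -/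
theorem sumPhi_cum {g : List (Fin 3) → D222}
    (hg : ∀ c d α, c ≠ d → Admissible (d :: α) → ρ (g (c :: d :: α)) = ρ.image c (g (d :: α)))
    (t : Fin 3) (n : ℕ) :
    ρ.sumPhi ((admSeqs t (n + 1)).sup fun α => g α.toList) =
      ρ ((admSeqs t (n + 2)).sup fun α => g α.toList) := by
  apply le_antisymm
  · have key : ∀ c d β, c ≠ d → Admissible (d :: β) → (d :: β).getLast? = some t →
        β.length = n → ρ.image c (g (d :: β)) ≤
          ρ ((admSeqs t (n + 2)).sup fun α => g α.toList) := by
      intro c d β hc h1 h2 hn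
      rw [← hg c d β hc h1]
      exact ρ.hom_mono (le_cum (admissible_cons hc h1) (by simpa using h2) (by simp [hn]))
    refine iSup_le fun c => ?_
    rw [ρ.coxeter.hom_finset_sup (admSeqs_nonempty t n), Submodule.map_le_iff_le_comap]
    refine Finset.sup_le fun α hα => ?_
    rw [← Submodule.map_le_iff_le_comap]
    obtain ⟨d, β, e, hn, h1, h2⟩ := exists_cons_of_mem hα
    rw [e]
    change ρ.image c (g (d :: β)) ≤ _
    by_cases hc : c = d
    · subst hc
      obtain ⟨j, l, h⟩ := exists_triple c
      exact (ρ.image_le_sup h _).trans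
        (sup_le (key _ _ _ h.ij.symm h1 h2 hn) (key _ _ _ h.il.symm h1 h2 hn))
    · exact key _ _ _ hc h1 h2 hn
  · rw [ρ.hom_finset_sup (admSeqs_nonempty t (n + 1))]
    refine Finset.sup_le fun α hα => ?_
    obtain ⟨c, β, e, hn, h1, h2⟩ := exists_cons_of_mem hα
    rw [e]
    cases β with
    | nil => simp at hn
    | cons d β =>
      obtain ⟨hc, h3⟩ : c ≠ d ∧ Admissible (d :: β) := List.isChain_cons_cons.1 h1
      rw [hg c d β hc h3]
      refine le_trans ?_ (ρ.image_le_sumPhi c _)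
      exact Submodule.map_mono (ρ.coxeter.hom_mono
        (le_cum h3 (by simpa using h2) (by simpa using hn)))

theorem sumPhi_cumX (t : Fin 3) (n : ℕ) : ρ.sumPhi (cumX t (n + 1)) = ρ (cumX t (n + 2)) :=
  ρ.sumPhi_cum (fun c d α hc h => by
    obtain ⟨h1, h2, -⟩ := ofSeq_spec d α h
    exact ρ.step_f h1 (by rwa [h2])) t n

theorem sumPhi_cumY (t : Fin 3) (n : ℕ) : ρ.sumPhi (cumY t (n + 1)) = ρ (cumY t (n + 2)) :=
  ρ.sumPhi_cum (fun c d α hc h => by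
    obtain ⟨h1, h2, -⟩ := ofSeq_spec d α h
    exact ρ.step_e h1 (by rwa [h2])) t n

theorem elemA_succ_succ (i : Fin 3) (n : ℕ) :
    ρ (elemA i (n + 2)) = ρ.sumPhi (elemA i (n + 1)) := by
  simp only [elemA, sumPhi_sup, sumPhi_cumX, sumPhi_cumY, map_sup]

theorem elemB_succ_succ (i : Fin 3) (n : ℕ) :
    ρ (elemB i (n + 2)) = ρ.sumPhi (elemB i (n + 1)) := by
  simp only [elemB, sumPhi_sup, sumPhi_cumX, elemA_succ_succ, map_sup]

theorem elemC_succ_succ (i : Fin 3) (n : ℕ) :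
    ρ (elemC i (n + 2)) = ρ.sumPhi (elemC i (n + 1)) := by
  simp only [elemC, sumPhi_sup, sumPhi_cumY, elemA_succ_succ, map_sup]

/-- The recursion from `a_i(0)` to `a_i(1)` has two additional summands, since `x_j(1) = x_j` and
`x_l(1) = x_l` do not arise from elements of `Φ⁺ρ`. -/
theorem elemA_one (i : Fin 3) :
    ρ (elemA i 1) = ρ.sumPhi (elemA i 0) ⊔ (ρ (x (i + 1)) ⊔ ρ (x (i + 2))) := by
  have h := ρ.sumPhi_cumY (n := 0)
  simp only [zero_add, cumY_one] at h
  simp only [elemA, zero_add, sumPhi_sup, h, map_sup, cumX_one]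
  ac_rfl

theorem elemB_one (i : Fin 3) :
    ρ (elemB i 1) = ρ.sumPhi (elemB i 0) ⊔ (ρ (x (i + 1)) ⊔ ρ (x (i + 2))) := by
  have h := ρ.sumPhi_cumX i 0
  simp only [zero_add, cumX_one] at h
  have e : ρ (elemB i 1) = ρ (elemA i 1) ⊔ ρ (cumX i 2) := map_sup _ _ _
  rw [e, elemA_one, ← h]
  simp only [elemB, elemA, sumPhi_sup]
  ac_rfl

theorem elemC_zero (i : Fin 3) : elemC i 0 = elemA i 0 ⊔ y i := by
  fin_cases i
  · change y 0 ⊔ y 1 ⊔ y 2 = y 1 ⊔ y 2 ⊔ y 0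
    rw [sup_assoc, sup_comm]
  · change y 0 ⊔ y 1 ⊔ y 2 = y 2 ⊔ y 0 ⊔ y 1
    rw [sup_comm, sup_assoc, ← sup_assoc, sup_comm (y 2)]
  · rfl

theorem elemC_one (i : Fin 3) :
    ρ (elemC i 1) = ρ.sumPhi (elemC i 0) ⊔ (ρ (x (i + 1)) ⊔ ρ (x (i + 2))) := by
  have h := ρ.sumPhi_cumY i 0
  simp only [zero_add, cumY_one] at h
  have e : ρ (elemC i 1) = ρ (elemA i 1) ⊔ ρ (cumY i 2) := map_sup _ _ _
  rw [e, elemC_zero, sumPhi_sup, elemA_one, ← h]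
  ac_rfl

end Rep
/-! ### Perfect elements -/

section Complement

variable {L : Type w} [Lattice L] [BoundedOrder L] [IsModularLattice L] [ComplementedLattice L]

/-- An element `b ≤ c` disjoint from `a` can be enlarged within `c` until it spans `c` modulo
`a`. -/
theorem exists_disjoint_extension {a b c : L} (hab : Disjoint a b) (hbc : b ≤ c) :
    ∃ d, b ≤ d ∧ d ≤ c ∧ Disjoint a d ∧ c ≤ a ⊔ d := by
  obtain ⟨e, he⟩ := exists_isCompl ((a ⊔ b) ⊓ c)
  have h1 : Disjoint (a ⊔ b) (e ⊓ c) := by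
    rw [disjoint_iff_inf_le, ← inf_assoc, inf_right_comm]
    exact he.disjoint.le_bot
  have h2 : c ≤ (a ⊔ b) ⊓ c ⊔ e ⊓ c := by
    rw [← sup_inf_assoc_of_le _ inf_le_right, he.sup_eq_top, top_inf_eq]
  refine ⟨b ⊔ e ⊓ c, le_sup_left, sup_le hbc inf_le_right,
    hab.disjoint_sup_right_of_disjoint_sup_left h1, h2.trans ?_⟩
  rw [← sup_assoc]
  exact sup_le_sup_right inf_le_left _

/-- Every element of a complemented modular lattice has a complement that is compatible with a
given chain `b ≤ c`. -/
theorem exists_isCompl_adapted (a : L) {b c : L} (hbc : b ≤ c) :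
    ∃ d, IsCompl a d ∧ b ≤ b ⊓ a ⊔ b ⊓ d ∧ c ≤ c ⊓ a ⊔ c ⊓ d := by
  obtain ⟨d₁, -, h1, h2, h3⟩ := exists_disjoint_extension (disjoint_bot_right (a := a))
    (bot_le (a := b))
  obtain ⟨d₂, h4, h5, h6, h7⟩ := exists_disjoint_extension h2 (h1.trans hbc)
  obtain ⟨d, h8, -, h9, h10⟩ := exists_disjoint_extension h6 (le_top (a := d₂))
  have key : ∀ {p q : L}, q ≤ p → q ≤ d → p ≤ a ⊔ q → p ≤ p ⊓ a ⊔ p ⊓ d := fun {p q} hp hd h => by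
    have : p = q ⊔ a ⊓ p := by
      rw [← sup_inf_assoc_of_le _ hp, sup_comm, inf_eq_right.2 h]
    calc p = q ⊔ a ⊓ p := this
      _ ≤ p ⊓ d ⊔ p ⊓ a := sup_le_sup (le_inf hp hd) (inf_comm a p).le
      _ = _ := sup_comm _ _
  exact ⟨d, ⟨h9, codisjoint_iff_le_sup.2 h10⟩, key h1 (h4.trans h8) h3, key h5 h8 h7⟩

end Complement

theorem eq_of_add_eq_add_of_disjoint {K : Type u} {V : Type v} [Ring K] [AddCommGroup V]
    [Module K V] {U W : Submodule K V} (h : Disjoint U W) {u u' w w' : V} (hu : u ∈ U)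
    (hu' : u' ∈ U) (hw : w ∈ W) (hw' : w' ∈ W) (e : u + w = u' + w') : u = u' ∧ w = w' := by
  have e' : u - u' = w' - w := by rw [sub_eq_sub_iff_add_eq_add, e, add_comm]
  have h0 : u - u' = 0 :=
    Submodule.disjoint_def.1 h _ (sub_mem hu hu') (e' ▸ sub_mem hw' hw)
  exact ⟨sub_eq_zero.1 h0, (sub_eq_zero.1 (e' ▸ h0)).symm⟩

namespace Rep

variable {K : Type u} {V : Type v} [Field K] [AddCommGroup V] [Module K V] (ρ : Rep K V)
  {i j l : Fin 3}

/-- The subspaces that are compatible with a decomposition `V = U ⊕ W` form a sublattice, so it is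
enough to test a decomposition of a representation on the generators. -/
theorem eq_sup_of_generators {U W : Submodule K V} (hUW : IsCompl U W)
    (hx : ∀ i, ρ (x i) ≤ ρ (x i) ⊓ U ⊔ ρ (x i) ⊓ W)
    (hy : ∀ i, ρ (y i) ≤ ρ (y i) ⊓ U ⊔ ρ (y i) ⊓ W) (a : D222) :
    ρ a = ρ a ⊓ U ⊔ ρ a ⊓ W := by
  refine le_antisymm ?_ (sup_le inf_le_left inf_le_left)
  obtain ⟨p, rfl⟩ := mk_surj a
  induction p with
  | x i => exact hx i
  | y i => exact hy i
  | one =>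
    rw [mk_one, ρ.map_top, top_inf_eq, top_inf_eq, hUW.sup_eq_top]
  | sum a b ha hb =>
    rw [mk_sum, map_sup]
    exact sup_le
      (ha.trans (sup_le_sup (inf_le_inf_right _ le_sup_left) (inf_le_inf_right _ le_sup_left)))
      (hb.trans (sup_le_sup (inf_le_inf_right _ le_sup_right) (inf_le_inf_right _ le_sup_right)))
  | meet a b ha hb =>
    rw [mk_meet, map_inf]
    rintro v ⟨hva, hvb⟩
    obtain ⟨u, ⟨hu, hu'⟩, w, ⟨hw, hw'⟩, rfl⟩ := Submodule.mem_sup.1 (ha hva)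
    obtain ⟨u₁, ⟨h1, h1'⟩, w₁, ⟨h2, h2'⟩, e⟩ := Submodule.mem_sup.1 (hb hvb)
    obtain ⟨rfl, rfl⟩ := eq_of_add_eq_add_of_disjoint hUW.disjoint h1' hu' h2' hw' e
    exact Submodule.add_mem_sup ⟨⟨hu, h1⟩, hu'⟩ ⟨⟨hw, h2⟩, hw'⟩

variable {ρ}

/-- A subspace that contains `Y_j` and `Y_l` has a complement compatible with the chain
`X_i ≤ Y_i`, so it is a direct summand. -/
theorem Indecomposable.eq_bot_or_eq_top (hρ : ρ.Indecomposable) (h : Triple i j l)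
    {N : Submodule K V} (hj : ρ (y j) ≤ N) (hl : ρ (y l) ≤ N) : N = ⊥ ∨ N = ⊤ := by
  obtain ⟨W, hW, h1, h2⟩ := exists_isCompl_adapted N (ρ.hom_mono (x_le_y i))
  have low : ∀ {p : Submodule K V}, p ≤ N → p ≤ p ⊓ N ⊔ p ⊓ W :=
    fun hp => le_sup_of_le_left (le_inf le_rfl hp)
  refine (hρ.2 N W hW (ρ.eq_sup_of_generators hW (fun s => ?_) fun s => ?_)).imp_right
    fun hW0 => ?_
  · rcases h.eq_or s with rfl | rfl | rfl
    · exact h1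
    · exact low ((ρ.hom_mono (x_le_y s)).trans hj)
    · exact low ((ρ.hom_mono (x_le_y s)).trans hl)
  · rcases h.eq_or s with rfl | rfl | rfl
    · exact h2
    · exact low hj
    · exact low hl
  · rw [← hW.sup_eq_top, hW0, sup_bot_eq]

theorem exists_space_apply (hY : ∀ j l, j ≠ l → ρ (y j) ⊔ ρ (y l) = ⊤) {v : V}
    (hv : v ∈ ρ (y i)) : ∃ η : ρ.space, η.1 i = v := by
  obtain ⟨j, l, h⟩ := exists_triple i
  obtain ⟨η, hη, -⟩ := (ρ.exists_space_iff h.rotate le_rfl le_rfl).2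
    ⟨hv, by rw [map_sup, hY _ _ h.jl]; trivial⟩
  exact ⟨η, hη⟩

theorem mem_iSup_map_phi {U : Submodule K ρ.space} {v : V}
    (hv : v ∈ ⨆ k, U.map (ρ.phi k)) :
    ∃ u : Fin 3 → ρ.space, (∀ k, u k ∈ U) ∧ ∑ k, (u k).1 k = v := by
  have h := triple_add 0
  have e : ⨆ k, U.map (ρ.phi k) = U.map (ρ.phi 0) ⊔ U.map (ρ.phi 1) ⊔ U.map (ρ.phi 2) := by
    refine le_antisymm (iSup_le fun k => ?_) (sup_le (sup_le ?_ ?_) ?_)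
    · fin_cases k
      · exact le_sup_of_le_left le_sup_left
      · exact le_sup_of_le_left le_sup_right
      · exact le_sup_right
    all_goals exact le_iSup (fun k => U.map (ρ.phi k)) _
  rw [e] at hv
  obtain ⟨_, hv', _, ⟨u₂, h₂, rfl⟩, rfl⟩ := Submodule.mem_sup.1 hv
  obtain ⟨_, ⟨u₀, h₀, rfl⟩, _, ⟨u₁, h₁, rfl⟩, rfl⟩ := Submodule.mem_sup.1 hv'
  refine ⟨![u₀, u₁, u₂], fun k => ?_, by rw [Fin.sum_univ_three]; rfl⟩
  fin_cases k
  · exact h₀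
  · exact h₁
  · exact h₂

/-- A decomposition `X_0^1 = U ⊕ W` of `Φ⁺ρ` induces the decomposition of the space of `ρ` into
`∑ φ_k(U)` and `∑ φ_k(W)`, provided that the subspaces `Y_i` span the space in pairs. -/
theorem Indecomposable.coxeter (hρ : ρ.Indecomposable)
    (hY : ∀ j l, j ≠ l → ρ (y j) ⊔ ρ (y l) = ⊤) : ρ.coxeter.Indecomposable := by
  have := hρ.1
  refine ⟨?_, fun U W hUW hdec => ?_⟩
  · by_contra hn
    rw [not_nontrivial_iff_subsingleton] at hn
    have hbot : ∀ i, ρ (y i) = ⊥ := fun i => (Submodule.eq_bot_iff _).2 fun v hv => by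
      obtain ⟨η, rfl⟩ := exists_space_apply hY hv
      rw [Subsingleton.elim η 0]
      rfl
    have := hY 0 1 (by decide)
    rw [hbot, hbot, sup_bot_eq] at this
    exact bot_ne_top this
  · let U' : Submodule K V := ⨆ k, U.map (ρ.phi k)
    let W' : Submodule K V := ⨆ k, W.map (ρ.phi k)
    have hU' : ∀ η ∈ U, ∀ k, η.1 k ∈ U' := fun η hη k =>
      le_iSup (fun k => U.map (ρ.phi k)) k ⟨η, hη, rfl⟩
    have hW' : ∀ η ∈ W, ∀ k, η.1 k ∈ W' := fun η hη k =>
      le_iSup (fun k => W.map (ρ.phi k)) k ⟨η, hη, rfl⟩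
    have hy : ∀ i, ρ (y i) ≤ ρ (y i) ⊓ U' ⊔ ρ (y i) ⊓ W' := fun i v hv => by
      obtain ⟨η, rfl⟩ := exists_space_apply hY hv
      obtain ⟨u, hu, w, hw, rfl⟩ := Submodule.mem_sup.1
        (hUW.sup_eq_top.symm ▸ Submodule.mem_top : η ∈ U ⊔ W)
      exact Submodule.add_mem_sup ⟨ρ.space_mem u i, hU' u hu i⟩ ⟨ρ.space_mem w i, hW' w hw i⟩
    have hx : ∀ i, ρ (x i) ≤ ρ (x i) ⊓ U' ⊔ ρ (x i) ⊓ W' := fun i v hv => by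
      obtain ⟨η, rfl⟩ := exists_space_apply hY (ρ.mem_of_le (x_le_y i) hv)
      have hη : η ∈ ρ.coxeter (y i) := hv
      rw [hdec (y i)] at hη
      obtain ⟨u, ⟨hu, hu'⟩, w, ⟨hw, hw'⟩, rfl⟩ := Submodule.mem_sup.1 hη
      exact Submodule.add_mem_sup ⟨hu, hU' u hu' i⟩ ⟨hw, hW' w hw' i⟩
    have hcompl : IsCompl U' W' := by
      refine ⟨Submodule.disjoint_def.2 fun v hvU hvW => ?_, codisjoint_iff_le_sup.2 ?_⟩
      · obtain ⟨u, hu, rfl⟩ := mem_iSup_map_phi hvU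
        obtain ⟨w, hw, e⟩ := mem_iSup_map_phi hvW
        -- The differences of the components form an element of `X_0^1`.
        let ζ : ρ.space := ⟨fun k => (u k).1 k - (w k).1 k,
          fun k => sub_mem (ρ.space_mem (u k) k) (ρ.space_mem (w k) k), by
            rw [Finset.sum_sub_distrib, e, sub_self]⟩
        obtain ⟨u', hu', w', hw', e'⟩ := Submodule.mem_sup.1
          (hUW.sup_eq_top.symm ▸ Submodule.mem_top : ζ ∈ U ⊔ W)
        have key : ∀ k, (u k).1 k = u'.1 k := fun k => by
          have hk : (u k - u') + -(w k + w') ∈ ρ.coxeter (x k) := by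
            have h1 : u'.1 k + w'.1 k = (u k).1 k - (w k).1 k :=
              congrArg (fun η : ρ.space => η.1 k) e'
            change (u k).1 k - u'.1 k + -((w k).1 k + w'.1 k) = 0
            rw [eq_sub_of_add_eq' h1]
            abel
          rw [hdec (x k)] at hk
          obtain ⟨a, ⟨ha, haU⟩, b, ⟨-, hbW⟩, eab⟩ := Submodule.mem_sup.1 hk
          obtain ⟨rfl, -⟩ := eq_of_add_eq_add_of_disjoint hUW.disjoint haU (sub_mem (hu k) hu')
            hbW (neg_mem (add_mem (hw k) hw')) eab
          exact sub_eq_zero.1 (ha : (u k).1 k - u'.1 k = 0)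
        rw [Finset.sum_congr rfl fun k _ => key k]
        exact u'.2.2
      · have hle : ∀ i, ρ (y i) ≤ U' ⊔ W' := fun i =>
          (hy i).trans (sup_le_sup inf_le_right inf_le_right)
        rw [← hY 0 1 (by decide)]
        exact sup_le (hle 0) (hle 1)
    have zero_of : ∀ T : Submodule K ρ.space, (⨆ k, T.map (ρ.phi k)) = ⊥ → T = ⊥ :=
      fun T hT => (Submodule.eq_bot_iff _).2 fun η hη => Subtype.ext (funext fun k =>
        (Submodule.mem_bot K).1 (hT ▸ le_iSup (fun k => T.map (ρ.phi k)) k ⟨η, hη, rfl⟩))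
    exact (hρ.2 U' W' hcompl (ρ.eq_sup_of_generators hcompl hx hy)).imp (zero_of U) (zero_of W)

/-- In an indecomposable representation either two of the `Y_i` vanish, or any two of them span
the space. -/
theorem Indecomposable.y_eq_bot_or_sup_eq_top (hρ : ρ.Indecomposable) :
    (∃ i j l, Triple i j l ∧ ρ (y j) = ⊥ ∧ ρ (y l) = ⊥) ∨
      ∀ j l, j ≠ l → ρ (y j) ⊔ ρ (y l) = ⊤ := by
  by_contra! hcon
  obtain ⟨h1, j, l, hjl, h2⟩ := hcon
  have h := (Triple.of_ne hjl).rotate.rotate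
  have h3 := (hρ.eq_bot_or_eq_top h le_sup_left le_sup_right).resolve_right h2
  rw [sup_eq_bot_iff] at h3
  exact h1 _ _ _ h h3.1 h3.2

theorem sumPhi_eq_bot_of_y_eq_bot (h : Triple i j l) (hj : ρ (y j) = ⊥) (hl : ρ (y l) = ⊥)
    (a : D222) : ρ.sumPhi a = ⊥ := by
  rw [eq_bot_iff]
  refine iSup_le fun k => ?_
  rintro _ ⟨η, -, rfl⟩
  have h2 : η.1 j = 0 := (Submodule.mem_bot K).1 (hj ▸ ρ.space_mem η j)
  have h3 : η.1 l = 0 := (Submodule.mem_bot K).1 (hl ▸ ρ.space_mem η l)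
  have h1 := ρ.space_sum h η
  rw [h2, h3, add_zero, add_zero] at h1
  change η.1 k = 0
  rcases h.eq_or k with rfl | rfl | rfl <;> assumption

theorem sumPhi_eq_bot {a : D222} (ha : ρ.coxeter a = ⊥) : ρ.sumPhi a = ⊥ := by
  simp [sumPhi, ha]

theorem sumPhi_eq_top (hY : ∀ j l, j ≠ l → ρ (y j) ⊔ ρ (y l) = ⊤) {a : D222}
    (ha : ρ.coxeter a = ⊤) : ρ.sumPhi a = ⊤ := by
  have hle : ∀ i, ρ (y i) ≤ ρ.sumPhi a := fun i v hv => by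
    obtain ⟨η, rfl⟩ := exists_space_apply hY hv
    exact ρ.image_le_sumPhi i a ⟨η, ha ▸ Submodule.mem_top, rfl⟩
  rw [eq_top_iff, ← hY 0 1 (by decide)]
  exact sup_le (hle 0) (hle 1)

end Rep

open Sextuple.Rep

variable {K : Type u} [Field K]

/-- The elementary maps carry perfect elements to perfect elements. -/
theorem IsPerfect.of_sumPhi {a b : D222} (ha : IsPerfect.{u, v} K a)
    (hb : ∀ (V : Type v) [AddCommGroup V] [Module K V] (ρ : Rep K V), ρ b = ρ.sumPhi a) :
    IsPerfect.{u, v} K b := by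
  intro V _ _ _ ρ hρ
  rw [hb V ρ]
  rcases hρ.y_eq_bot_or_sup_eq_top with ⟨i, j, l, h, hj, hl⟩ | hY
  · exact .inl (sumPhi_eq_bot_of_y_eq_bot h hj hl a)
  · exact (ha _ _ (hρ.coxeter hY)).imp sumPhi_eq_bot (sumPhi_eq_top hY)

/-- Summands `x_j`, `x_l` with `y_j`, `y_l ≤ a` do not disturb perfection: if any two `Y_i` span the
space and `Φ⁺ρ(a) = 0`, then `Φ⁺ρ(y_j) = 0`, which means `ρ(x_j) = 0`. -/
theorem IsPerfect.of_sumPhi_sup {a b : D222} {j l : Fin 3} (ha : IsPerfect.{u, v} K a)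
    (hj : y j ≤ a) (hl : y l ≤ a)
    (hb : ∀ (V : Type v) [AddCommGroup V] [Module K V] (ρ : Rep K V),
      ρ b = ρ.sumPhi a ⊔ (ρ (x j) ⊔ ρ (x l))) :
    IsPerfect.{u, v} K b := by
  intro V _ _ _ ρ hρ
  rw [hb V ρ]
  rcases hρ.y_eq_bot_or_sup_eq_top with ⟨i, i', i'', h, h1, h2⟩ | hY
  · have hx : ∀ s, ρ (x s) = ⊥ ∨ ρ (x s) = ⊤ := fun s => by
      rcases h.eq_or s with rfl | rfl | rfl
      · exact hρ.eq_bot_or_eq_top h (h1.le.trans bot_le) (h2.le.trans bot_le)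
      · exact .inl (le_bot_iff.1 ((ρ.hom_mono (x_le_y s)).trans h1.le))
      · exact .inl (le_bot_iff.1 ((ρ.hom_mono (x_le_y s)).trans h2.le))
    rw [sumPhi_eq_bot_of_y_eq_bot h h1 h2 a]
    rcases hx j with e | e <;> rcases hx l with e' | e' <;> simp [e, e']
  · rcases ha _ _ (hρ.coxeter hY) with h0 | h0
    · have hx : ∀ s, y s ≤ a → ρ (x s) = ⊥ := fun s hs => (Submodule.eq_bot_iff _).2 fun v hv => by
        obtain ⟨η, rfl⟩ := exists_space_apply hY (ρ.mem_of_le (x_le_y s) hv)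
        have hη : η ∈ ρ.coxeter a := ρ.coxeter.hom_mono hs hv
        rw [h0, Submodule.mem_bot] at hη
        rw [hη]
        rfl
      left
      rw [sumPhi_eq_bot h0, hx j hj, hx l hl, sup_bot_eq, sup_bot_eq]
    · right
      rw [sumPhi_eq_top hY h0, top_sup_eq]

/-- An element that contains two of the `y_i` is perfect. -/
theorem isPerfect_of_y_le {a : D222} {i j l : Fin 3} (h : Triple i j l) (hj : y j ≤ a)
    (hl : y l ≤ a) : IsPerfect.{u, v} K a :=
  fun _ _ _ _ ρ hρ => hρ.eq_bot_or_eq_top h (ρ.hom_mono hj) (ρ.hom_mono hl)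

/-- Perfection of the terms of a sequence whose first term contains `y_j` and `y_l` and in which
every term arises from its predecessor by applying the elementary maps, with the additional
summands `x_j` and `x_l` in the first step. -/
theorem isPerfect_of_recursion {g : ℕ → D222} {i j l : Fin 3} (h : Triple i j l)
    (hj : y j ≤ g 0) (hl : y l ≤ g 0)
    (h1 : ∀ (V : Type v) [AddCommGroup V] [Module K V] (ρ : Rep K V),
      ρ (g 1) = ρ.sumPhi (g 0) ⊔ (ρ (x j) ⊔ ρ (x l)))
    (h2 : ∀ (n : ℕ) (V : Type v) [AddCommGroup V] [Module K V] (ρ : Rep K V),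
      ρ (g (n + 2)) = ρ.sumPhi (g (n + 1))) (n : ℕ) : IsPerfect.{u, v} K (g n) := by
  rcases n with _ | n
  · exact isPerfect_of_y_le h hj hl
  · induction n with
    | zero => exact (isPerfect_of_y_le h hj hl).of_sumPhi_sup hj hl h1
    | succ n ih => exact ih.of_sumPhi (h2 n)

theorem isPerfect_elemA (i : Fin 3) (n : ℕ) : IsPerfect.{u, v} K (elemA i n) :=
  isPerfect_of_recursion (triple_add i) le_sup_left le_sup_right
    (fun _ _ _ ρ => ρ.elemA_one i) (fun n _ _ _ ρ => ρ.elemA_succ_succ i n) n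

theorem isPerfect_elemB (i : Fin 3) (n : ℕ) : IsPerfect.{u, v} K (elemB i n) :=
  isPerfect_of_recursion (triple_add i) (le_sup_of_le_left le_sup_right) le_sup_right
    (fun _ _ _ ρ => ρ.elemB_one i) (fun n _ _ _ ρ => ρ.elemB_succ_succ i n) n

theorem isPerfect_elemC (i : Fin 3) (n : ℕ) : IsPerfect.{u, v} K (elemC i n) :=
  isPerfect_of_recursion (triple_add i)
    (elemC_zero i ▸ le_sup_of_le_left le_sup_left) (elemC_zero i ▸ le_sup_of_le_left le_sup_right)
    (fun _ _ _ ρ => ρ.elemC_one i) (fun n _ _ _ ρ => ρ.elemC_succ_succ i n) n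

end Sextuple

theorem mainTheorem3 (K : Type u) [Field K] :
    (∀ (V : Type v) [AddCommGroup V] [Module K V] [FiniteDimensional K V]
        (ρ : Sextuple.Rep K V) (i : Fin 3) (n : ℕ), 2 ≤ n →
      ρ (Sextuple.elemA i n) = ρ.sumPhi (Sextuple.elemA i (n - 1)) ∧
      ρ (Sextuple.elemB i n) = ρ.sumPhi (Sextuple.elemB i (n - 1)) ∧
      ρ (Sextuple.elemC i n) = ρ.sumPhi (Sextuple.elemC i (n - 1))) ∧
    (∀ (i : Fin 3) (n : ℕ), 1 ≤ n →
      Sextuple.IsPerfect.{u, v} K (Sextuple.elemA i n) ∧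
      Sextuple.IsPerfect.{u, v} K (Sextuple.elemB i n) ∧
      Sextuple.IsPerfect.{u, v} K (Sextuple.elemC i n)) := by
  refine ⟨fun V _ _ _ ρ i n hn => ?_, fun i n _ =>
    ⟨Sextuple.isPerfect_elemA i n, Sextuple.isPerfect_elemB i n, Sextuple.isPerfect_elemC i n⟩⟩
  obtain ⟨n, rfl⟩ := Nat.exists_eq_add_of_le' hn
  exact ⟨ρ.elemA_succ_succ i n, ρ.elemB_succ_succ i n, ρ.elemC_succ_succ i n⟩
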